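/- For integers $s,t>1$ and $n\ge 0$, let $B_{s,t}(n)$ denote the number of $(s,t)$-regular bipartitions of $n$, that is, of ordered pairs $(\lambda,\mu)$ of (possibly empty) integer partitions such that the sum of all parts of $\lambda$ and $\mu$ is $n$, no part of $\lambda$ is divisible by $s$, and no part of $\mu$ is divisible by $t$. Then for all integers $n\ge 0$ and $m\ge 0$, $$B_{7,11}\left(7^{12m}n+\frac{2\cdot 7^{12m}-2}{3}\right)\equiv 3^m B_{7,11}(n)\pmod{11},$$ and $$B_{7,11}\left(7^{12m+11}(7n+k)+\frac{2\cdot 7^{12m+11}-2}{3}\right)\equiv 0\pmod{11}\qquad\text{for } k=1,5,6.$$ -/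

import Mathlib

/-- The finite set of `(s, t)`-regular bipartitions of `n`: pairs `(lam, mu)` where `lam` is a
partition of some `a`, `mu` is a partition of some `b`, `a + b = n`, no part of `lam` is divisible
by `s`, and no part of `mu` is divisible by `t`. -/
def regularBipartitions (s t n : ℕ) :
    Finset (Σ p : ℕ × ℕ, Nat.Partition p.1 × Nat.Partition p.2) :=
  (Finset.HasAntidiagonal.antidiagonal n).sigma fun p =>
    Nat.Partition.restricted p.1 (fun i => ¬ s ∣ i) ×ˢ
      Nat.Partition.restricted p.2 (fun i => ¬ t ∣ i)

/-- `B s t n` is the number of `(s, t)`-regular bipartitions of `n`. -/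
def B (s t n : ℕ) : ℕ := (regularBipartitions s t n).card

/-!
Write `f_k = ∏ (1 - X ^ (k n))`. The generating function of `B 7 11` is `f_7 f_11 / f_1 ^ 2`, which
modulo 11 equals `f_1 ^ 9 f_7`. Up to powers of `X`, this is the eta product `η(z) ^ 9 η(7 z)`, and
passing from the coefficients at `n` to those at `7 n + 4` is the operator `U_7`. The space spanned
by `f_1 ^ 9 f_7`, `X f_1 ^ 5 f_7 ^ 5` and `X ^ 2 f_1 f_7 ^ 9` is stable under `U_7`, with an explicit
integral 3 × 3 matrix (`extract_etaProduct_zero`, `extract_etaProduct_one`,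
`extract_etaProduct_two`). Modulo 11 its eleventh power sends the first vector to `-3` times the
third, and its twelfth power sends the first vector to 3 times itself. This gives the first
congruence. The exponents of the third vector are governed modulo 7 by those of `f_1`, which are
generalized pentagonal numbers, and so avoid the residues 1, 5 and 6; this gives the second.

The matrix is found from the 7-dissection `f_1 = a + b + c + d`, where the exponents in the four
parts are congruent to `0, 1, 2, 5` modulo 7. The pentagonal number theorem gives
`c = -X ^ 2 f_49`. Jacobi's identity for `f_1 ^ 3`, obtained here by differentiating a finite
`q`-binomial theorem, shows that the components of `f_1 ^ 3` at the residues 2, 4, 5 vanish and that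
the one at 6 is `7 c ^ 3`; this amounts to four polynomial relations between `a, b, c, d`
(`euler_component_relations`). Under these relations the product of the conjugates of `f_1` under
`X ↦ ζ X`, with `ζ` a primitive seventh root of unity, becomes a square divided by `-c`. On the other
hand that product is `f_7 ^ 8 / f_49`, so a square root expresses `f_7 ^ 4` through `a, b, c, d`
(`euler_component_quartic`). The required components of `f_1 ^ 9` and `f_1 ^ 5` are polynomials in
`a, b, c, d` and reduce to polynomials in `f_7 ^ 4` and `f_49`.
-/

/-! ### The finite Jacobi identity -/

section FiniteJacobi

variable {A : Type*} [CommRing A]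

/-- The finite product `(q; q)_n = (1 - q)(1 - q ^ 2) ⋯ (1 - q ^ n)`. -/
def qFactorial (q : A) (n : ℕ) : A := ∏ i ∈ Finset.range n, (1 - q ^ (i + 1))

/-- The Gaussian binomial coefficient, given by its Pascal recursion, so that no division is
needed. -/
def gaussBinom (q : A) : ℕ → ℕ → A
  | _, 0 => 1
  | 0, _ + 1 => 0
  | N + 1, k + 1 => gaussBinom q N (k + 1) + q ^ (N - k) * gaussBinom q N k

lemma gaussBinom_zero_right (q : A) (N : ℕ) : gaussBinom q N 0 = 1 := by
  cases N <;> rfl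

lemma gaussBinom_succ_succ (q : A) (N k : ℕ) :
    gaussBinom q (N + 1) (k + 1) = gaussBinom q N (k + 1) + q ^ (N - k) * gaussBinom q N k := rfl

lemma gaussBinom_eq_zero_of_lt (q : A) : ∀ {N k : ℕ}, N < k → gaussBinom q N k = 0
  | 0, _ + 1, _ => rfl
  | N + 1, k + 1, h => by
    rw [gaussBinom_succ_succ, gaussBinom_eq_zero_of_lt q (by omega : N < k + 1),
      gaussBinom_eq_zero_of_lt q (by omega : N < k)]
    ring

lemma gaussBinom_self (q : A) (N : ℕ) : gaussBinom q N N = 1 := by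
  induction N with
  | zero => rfl
  | succ N ih => simp [gaussBinom_succ_succ, ih, gaussBinom_eq_zero_of_lt]

lemma qFactorial_succ (q : A) (n : ℕ) :
    qFactorial q (n + 1) = qFactorial q n * (1 - q ^ (n + 1)) := by
  simp [qFactorial, Finset.prod_range_succ]

/-- The product formula for Gaussian binomials, free of division. -/
lemma gaussBinom_mul_qFactorial (q : A) (N : ℕ) : ∀ k i : ℕ, k + i = N →
    gaussBinom q N k * qFactorial q k * qFactorial q i = qFactorial q N := by
  induction N with
  | zero =>
    intro k i h
    obtain ⟨rfl, rfl⟩ : k = 0 ∧ i = 0 := by omega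
    simp [gaussBinom_zero_right, qFactorial]
  | succ N ih =>
    intro k i h
    rcases k with _ | k
    · obtain rfl : i = N + 1 := by omega
      simp [gaussBinom_zero_right, qFactorial]
    rcases i with _ | i
    · obtain rfl : k = N := by omega
      simp [gaussBinom_self, qFactorial]
    have h1 := ih (k + 1) i (by omega)
    have h2 := ih k (i + 1) (by omega)
    have h3 : N - k = i + 1 := by omega
    have h4 : q ^ (N + 1) = q ^ (i + 1) * q ^ (k + 1) := by rw [← pow_add]; congr 1; omega
    rw [gaussBinom_succ_succ, h3, qFactorial_succ q N, h4]
    rw [qFactorial_succ] at h1 h2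
    rw [qFactorial_succ, qFactorial_succ]
    linear_combination (1 - q ^ (i + 1)) * h1 + q ^ (i + 1) * (1 - q ^ (k + 1)) * h2

open Polynomial in
/-- The `q`-binomial theorem, in a homogeneous form that avoids negative powers of `q` when it is
used with `y = q ^ n`. -/
lemma prod_sub_eq_sum_gaussBinom (q y : A) (N : ℕ) :
    ∏ i ∈ Finset.range N, (C y - C (q ^ i) * X) =
      ∑ k ∈ Finset.range (N + 1),
        C ((-1) ^ k * q ^ k.choose 2 * gaussBinom q N k * y ^ (N - k)) * X ^ k := by
  induction N with
  | zero => simp [gaussBinom_zero_right]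
  | succ N ih =>
    rw [Finset.prod_range_succ, ih, Finset.sum_range_succ' _ (N + 1), mul_sub, Finset.sum_mul]
    have h1 : ∑ k ∈ Finset.range (N + 1),
          C ((-1) ^ k * q ^ k.choose 2 * gaussBinom q N k * y ^ (N - k)) * X ^ k * C y =
        ∑ k ∈ Finset.range (N + 1),
          C ((-1) ^ (k + 1) * q ^ (k + 1).choose 2 * gaussBinom q N (k + 1) * y ^ (N - k)) *
            X ^ (k + 1) + C (y ^ (N + 1)) := by
      rw [Finset.sum_range_succ', Finset.sum_range_succ _ N,
        gaussBinom_eq_zero_of_lt q (Nat.lt_succ_self N)]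
      simp only [mul_zero, zero_mul, C_0, add_zero, gaussBinom_zero_right, Nat.choose_zero_succ,
        pow_zero, mul_one, one_mul, Nat.sub_zero]
      rw [← C_mul, ← pow_succ]
      congr 1
      refine Finset.sum_congr rfl fun k hk => ?_
      rw [Finset.mem_range] at hk
      obtain ⟨i, rfl⟩ : ∃ i, N = k + 1 + i := ⟨N - (k + 1), by omega⟩
      rw [show k + 1 + i - (k + 1) = i by omega, show k + 1 + i - k = i + 1 by omega]
      simp only [C_mul, C_pow]
      ring
    rw [h1, Finset.sum_mul]
    rw [add_sub_right_comm, ← Finset.sum_sub_distrib]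
    simp only [gaussBinom_zero_right, Nat.choose_zero_succ, pow_zero, mul_one, one_mul,
      Nat.sub_zero]
    congr 1
    refine Finset.sum_congr rfl fun k hk => ?_
    rw [Finset.mem_range] at hk
    rw [gaussBinom_succ_succ, show N + 1 - (k + 1) = N - k by omega,
      show (k + 1).choose 2 = k + k.choose 2 by
        rw [Nat.choose_succ_succ' k 1, Nat.choose_one_right]]
    have h4 : q ^ N = q ^ k * q ^ (N - k) := by rw [← pow_add]; congr 1; omega
    rw [h4]
    simp only [C_mul, C_pow, C_add, C_neg, C_1]
    ring

lemma prod_pow_sub_pow_eq_qFactorial (q : A) (n : ℕ) :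
    ∏ i ∈ Finset.range n, (q ^ n - q ^ i) = (-1) ^ n * q ^ n.choose 2 * qFactorial q n := by
  have h : ∀ i ∈ Finset.range n, q ^ n - q ^ i = (-1) * q ^ i * (1 - q ^ (n - 1 - i + 1)) := by
    intro i hi
    rw [Finset.mem_range] at hi
    have : q ^ n = q ^ i * q ^ (n - 1 - i + 1) := by rw [← pow_add]; congr 1; omega
    rw [this]; ring
  rw [Finset.prod_congr rfl h, Finset.prod_mul_distrib, Finset.prod_mul_distrib,
    Finset.prod_pow_eq_pow_sum, Finset.prod_const, Finset.card_range, Finset.sum_range_id,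
    Finset.prod_range_reflect (fun i => 1 - q ^ (i + 1)), Nat.choose_two_right]
  rfl

lemma gaussBinom_symm [IsDomain A] {q : A} (hq : ∀ n, qFactorial q n ≠ 0) {N k i : ℕ}
    (h : k + i = N) : gaussBinom q N k = gaussBinom q N i := by
  refine mul_right_cancel₀ (mul_ne_zero (hq k) (hq i)) ?_
  linear_combination gaussBinom_mul_qFactorial q N k i h -
    gaussBinom_mul_qFactorial q N i k (by omega)

lemma two_mul_choose_two (n : ℕ) : 2 * (n + 1).choose 2 = n * (n + 1) := by
  have h2 := Nat.choose_two_right (n + 1)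
  have h3 : 2 ∣ (n + 1) * (n + 1 - 1) := (Nat.even_mul_pred_self (n + 1)).two_dvd
  rw [h2, Nat.mul_div_cancel' h3, Nat.add_sub_cancel, mul_comm]

open Polynomial in
/-- The finite form of Jacobi's identity. It is the `q`-binomial theorem
for `∏ i < 2 n + 1, (q ^ n - q ^ i z)` differentiated at `z = 1`, where the factor `i = n`
vanishes. -/
lemma sum_gaussBinom_eq_qFactorial_sq [IsDomain A] {q : A} (hq0 : q ≠ 0)
    (hq : ∀ n, qFactorial q n ≠ 0) (n : ℕ) :
    ∑ j ∈ Finset.range (n + 1), (-1) ^ j * (2 * j + 1) *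
        q ^ (j + 1).choose 2 * gaussBinom q (2 * n + 1) (n - j) = qFactorial q n ^ 2 := by
  refine mul_left_cancel₀ (pow_ne_zero (n * n + (n + 1).choose 2) hq0) ?_
  have key := congrArg (fun p => (derivative p).eval 1)
    (prod_sub_eq_sum_gaussBinom q (q ^ n) (2 * n + 1))
  have hl : ∏ i ∈ Finset.range (2 * n + 1), (C (q ^ n) - C (q ^ i) * X) =
      (1 - X) * (C (q ^ n) * (∏ i ∈ Finset.range n, (C (q ^ n) - C (q ^ i) * X)) *
        ∏ i ∈ Finset.range n, (C (q ^ n) - C (q ^ (n + 1 + i)) * X)) := by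
    rw [show 2 * n + 1 = n + 1 + n by ring, Finset.prod_range_add, Finset.prod_range_succ]
    ring
  have hd (h : A[X]) : (derivative ((1 - X) * h)).eval 1 = -h.eval 1 := by simp
  have h2 : ∏ i ∈ Finset.range n, (q ^ n - q ^ (n + 1 + i)) = q ^ (n * n) * qFactorial q n := by
    have h3 : (q ^ n) ^ n = ∏ _i ∈ Finset.range n, q ^ n := by simp
    rw [qFactorial, pow_mul, h3, ← Finset.prod_mul_distrib]
    exact Finset.prod_congr rfl fun i _ => by ring
  simp only [hl, hd] at key
  simp only [eval_mul, eval_prod, eval_sub, eval_C, eval_X, mul_one, h2,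
    prod_pow_sub_pow_eq_qFactorial, derivative_sum, eval_finsetSum, derivative_C_mul_X_pow,
    eval_pow, one_pow] at key
  rw [show 2 * n + 1 + 1 = (n + 1) + (n + 1) by ring, Finset.sum_range_add,
    ← Finset.sum_range_reflect, ← Finset.sum_add_distrib] at key
  -- The terms with indices `n - j` and `n + 1 + j` carry the same power of `q`.
  have hterm : ∀ j ∈ Finset.range (n + 1),
      (-1) ^ (n + 1 - 1 - j) * q ^ (n + 1 - 1 - j).choose 2 *
          gaussBinom q (2 * n + 1) (n + 1 - 1 - j) * (q ^ n) ^ (2 * n + 1 - (n + 1 - 1 - j)) *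
          ((n + 1 - 1 - j : ℕ) : A) +
        (-1) ^ (n + 1 + j) * q ^ (n + 1 + j).choose 2 * gaussBinom q (2 * n + 1) (n + 1 + j) *
          (q ^ n) ^ (2 * n + 1 - (n + 1 + j)) * ((n + 1 + j : ℕ) : A) =
      -(-1) ^ n * (q ^ (n * n + (n + 1).choose 2) * ((-1) ^ j * (2 * j + 1) *
        q ^ (j + 1).choose 2 * gaussBinom q (2 * n + 1) (n - j))) := by
    intro j hj
    rw [Finset.mem_range] at hj
    obtain ⟨i, rfl⟩ : ∃ i, n = i + j := ⟨n - j, by omega⟩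
    rw [show i + j + 1 - 1 - j = i by omega, show i + j - j = i by omega,
      show 2 * (i + j) + 1 - i = i + j + 1 + j by omega,
      show 2 * (i + j) + 1 - (i + j + 1 + j) = i by omega,
      gaussBinom_symm hq (show i + j + 1 + j + i = 2 * (i + j) + 1 by ring),
      ← pow_mul, ← pow_mul]
    have t1 := two_mul_choose_two i
    have t2 := two_mul_choose_two j
    have t3 := two_mul_choose_two (i + j)
    have t4 := two_mul_choose_two (i + j + j)
    have t5 : (i + 1).choose 2 = i + i.choose 2 := by
      rw [Nat.choose_succ_succ' i 1, Nat.choose_one_right]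
    have e1 : i.choose 2 + (i + j) * (i + j + 1 + j) =
        (i + j) * (i + j) + (i + j + 1).choose 2 + (j + 1).choose 2 := by
      rw [t5] at t1
      nlinarith
    have e2 : (i + j + 1 + j).choose 2 + (i + j) * i =
        (i + j) * (i + j) + (i + j + 1).choose 2 + (j + 1).choose 2 := by
      rw [show i + j + 1 + j = i + j + j + 1 by ring]
      nlinarith
    have e1' := congrArg (q ^ ·) e1
    have e2' := congrArg (q ^ ·) e2
    simp only [pow_add _ (Nat.choose _ _) _, pow_add _ _ (Nat.choose _ _)] at e1' e2' ⊢
    have hs : ((-1 : A) ^ j) * (-1) ^ j = 1 := by rw [← pow_add, Even.neg_one_pow ⟨j, rfl⟩]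
    have hs1 : (-1 : A) ^ i = (-1) ^ (i + j) * (-1) ^ j := by
      rw [pow_add, mul_assoc, hs, mul_one]
    have hs2 : (-1 : A) ^ (i + j + 1 + j) = - ((-1) ^ (i + j) * (-1) ^ j) := by ring
    rw [hs1, hs2]
    push_cast
    linear_combination
      (-1) ^ (i + j) * (-1) ^ j * gaussBinom q (2 * (i + j) + 1) i * i * e1' -
      (-1) ^ (i + j) * (-1) ^ j * gaussBinom q (2 * (i + j) + 1) i * (i + j + 1 + j) * e2'
  rw [Finset.sum_congr rfl hterm, ← Finset.mul_sum, ← Finset.mul_sum] at key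
  have hs : ((-1 : A) ^ n) * (-1) ^ n = 1 := by rw [← pow_add, Even.neg_one_pow ⟨n, rfl⟩]
  have hc : (n + 1).choose 2 = n + n.choose 2 := by
    rw [Nat.choose_succ_succ' n 1, Nat.choose_one_right]
  generalize ∑ j ∈ Finset.range (n + 1), (-1) ^ j * (2 * (j : A) + 1) *
        q ^ (j + 1).choose 2 * gaussBinom q (2 * n + 1) (n - j) = s at key ⊢
  have key' := congrArg ((-1) ^ n * ·) key
  simp only [hc, pow_add] at key' ⊢
  linear_combination key' - (q ^ (n * n) * (q ^ n * q ^ n.choose 2) * s -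
    q ^ (n * n) * (q ^ n * q ^ n.choose 2) * qFactorial q n ^ 2) * hs

end FiniteJacobi

/-! ### Jacobi's identity for the cube of Euler's product -/

section Jacobi

open PowerSeries

variable {R : Type*} [CommRing R]

lemma X_pow_dvd_qFactorial_add_sub (n k : ℕ) :
    (X : R⟦X⟧) ^ (n + 1) ∣ qFactorial X (n + k) - qFactorial X n := by
  induction k with
  | zero => simp
  | succ k ih =>
    rw [← add_assoc, qFactorial_succ]
    have h : (X : R⟦X⟧) ^ (n + 1) ∣ qFactorial X (n + k) * X ^ (n + k + 1) :=
      Dvd.dvd.mul_left (pow_dvd_pow X (by omega)) _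
    convert! dvd_sub ih h using 1
    ring

lemma X_pow_dvd_pentagonalSeries_sub_qFactorial (n : ℕ) :
    (X : R⟦X⟧) ^ (n + 1) ∣ pentagonalSeries R - qFactorial X n := by
  rw [X_pow_dvd_iff]
  intro m hm
  obtain ⟨s, hs⟩ := Filter.eventually_atTop.mp (coeff_prod_one_sub_X_pow_eventually_eq R m)
  obtain ⟨N, hN⟩ := s.exists_nat_subset_range
  have h1 := hs (Finset.range (n + N)) (hN.trans (Finset.range_subset_range.mpr (by omega)))
  have h2 := X_pow_dvd_iff.mp (X_pow_dvd_qFactorial_add_sub (R := R) n N) m hm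
  rw [map_sub, ← h1]
  rw [map_sub] at h2
  exact h2

lemma constantCoeff_qFactorial_X (n : ℕ) :
    constantCoeff (qFactorial (X : R⟦X⟧) n) = 1 := by
  simp [qFactorial, map_prod]

lemma constantCoeff_pentagonalSeries : constantCoeff (pentagonalSeries R) = 1 := by
  simpa [pentagonal_def] using coeff_pentagonalSeries_pentagonal R 0

/-- Jacobi's identity `∏ (1 - X ^ n) ^ 3 = ∑ (-1) ^ j (2 j + 1) X ^ (j (j + 1) / 2)`, with the
right-hand side truncated. -/
lemma X_pow_dvd_pentagonalSeries_cube_sub [IsDomain R] (M : ℕ) :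
    (X : R⟦X⟧) ^ M ∣ pentagonalSeries R ^ 3 -
      ∑ j ∈ Finset.range M, (-1) ^ j * (2 * (j : R⟦X⟧) + 1) * X ^ (j + 1).choose 2 := by
  have hq (n : ℕ) : qFactorial (X : R⟦X⟧) n ≠ 0 := fun h => by
    simpa [h] using constantCoeff_qFactorial_X (R := R) n
  have hJ := sum_gaussBinom_eq_qFactorial_sq (X_ne_zero : (X : R⟦X⟧) ≠ 0) hq (2 * M)
  -- In the quotient by `X ^ M` all long enough finite products agree with the infinite one.
  let π := Ideal.Quotient.mk (Ideal.span {(X : R⟦X⟧) ^ M})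
  have hπ {f g : R⟦X⟧} : π f = π g ↔ X ^ M ∣ f - g := by
    rw [Ideal.Quotient.eq, Ideal.mem_span_singleton]
  have hP (n : ℕ) (hn : M ≤ n) : π (qFactorial X n) = π (pentagonalSeries R) :=
    (hπ.mpr ((pow_dvd_pow X (by omega)).trans
      (X_pow_dvd_pentagonalSeries_sub_qFactorial n))).symm
  have hu : IsUnit (π (pentagonalSeries R)) := by
    refine IsUnit.map π (isUnit_iff_constantCoeff.mpr ?_)
    rw [constantCoeff_pentagonalSeries]
    exact isUnit_one
  have hG (j : ℕ) (hj : j < M) :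
      π (gaussBinom X (2 * (2 * M) + 1) (2 * M - j)) * π (pentagonalSeries R) = 1 := by
    have h := congrArg π (gaussBinom_mul_qFactorial (X : R⟦X⟧) (2 * (2 * M) + 1) (2 * M - j)
      (2 * M + 1 + j) (by omega))
    rw [map_mul, map_mul, hP _ (by omega), hP _ (by omega), hP _ (by omega)] at h
    exact hu.mul_right_cancel (by rw [h, one_mul])
  have hX (j : ℕ) (hj : M ≤ j) : π (X ^ (j + 1).choose 2) = 0 := by
    rw [Ideal.Quotient.eq_zero_iff_mem, Ideal.mem_span_singleton]
    refine pow_dvd_pow X (hj.trans ?_)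
    rw [Nat.choose_succ_succ' j 1, Nat.choose_one_right]
    omega
  rw [← hπ]
  have h := congrArg (fun f => π f * π (pentagonalSeries R)) hJ
  rw [map_pow π (qFactorial _ _), hP _ (by omega), ← pow_succ, ← map_pow] at h
  rw [← h, map_sum, map_sum, Finset.sum_mul, show 2 * M + 1 = M + (M + 1) by ring,
    Finset.sum_range_add, Finset.sum_eq_zero (s := Finset.range (M + 1)), add_zero]
  · refine Finset.sum_congr rfl fun j hj => ?_
    rw [map_mul π _ (gaussBinom _ _ _), mul_assoc, hG j (Finset.mem_range.mp hj), mul_one]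
  · intro j _
    rw [map_mul, map_mul, hX (M + j) (by omega), mul_zero, zero_mul, zero_mul]

lemma coeff_pentagonalSeries_cube [IsDomain R] (n : ℕ) :
    coeff n (pentagonalSeries R ^ 3) = ∑ j ∈ Finset.range (n + 1),
      if n = (j + 1).choose 2 then (-1) ^ j * (2 * (j : R) + 1) else 0 := by
  have h := X_pow_dvd_iff.mp (X_pow_dvd_pentagonalSeries_cube_sub (R := R) (n + 1)) n (by omega)
  rw [map_sub, sub_eq_zero] at h
  rw [h, map_sum]
  refine Finset.sum_congr rfl fun j _ => ?_
  rw [show (-1) ^ j * (2 * (j : R⟦X⟧) + 1) = C ((-1) ^ j * (2 * (j : R) + 1)) by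
      rw [map_mul, map_add, map_mul, map_pow, map_neg, map_one, map_natCast, map_ofNat],
    coeff_C_mul, coeff_X_pow, mul_ite, mul_one, mul_zero]

lemma choose_two_succ_injective : Function.Injective fun j : ℕ => (j + 1).choose 2 := by
  intro i j h
  have h1 := two_mul_choose_two i
  have h2 := two_mul_choose_two j
  simp only at h
  rw [h] at h1
  rcases lt_trichotomy i j with h3 | h3 | h3
  · nlinarith
  · exact h3
  · nlinarith

lemma coeff_pentagonalSeries_cube_triangular [IsDomain R] (j : ℕ) :
    coeff ((j + 1).choose 2) (pentagonalSeries R ^ 3) = (-1) ^ j * (2 * (j : R) + 1) := by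
  rw [coeff_pentagonalSeries_cube, Finset.sum_eq_single_of_mem j]
  · simp
  · rw [Finset.mem_range, Nat.choose_succ_succ' j 1, Nat.choose_one_right]
    omega
  · intro i _ hi
    exact if_neg fun h => hi (choose_two_succ_injective h.symm)

lemma coeff_pentagonalSeries_cube_eq_zero [IsDomain R] {n : ℕ}
    (h : ∀ j : ℕ, n ≠ (j + 1).choose 2) : coeff n (pentagonalSeries R ^ 3) = 0 := by
  rw [coeff_pentagonalSeries_cube]
  exact Finset.sum_eq_zero fun j _ => if_neg (h j)

end Jacobi

/-! ### Euler products in a dilated variable -/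

section EulerProduct

open PowerSeries PowerSeries.WithPiTopology

variable (R : Type*) [CommRing R]

/-- Euler's product `∏ n ≥ 1, (1 - X ^ (k n))`, usually written `f_k`. It is defined by dilating the
pentagonal series, so that coefficients and products are both at hand. -/
noncomputable def euler (k : ℕ) [NeZero k] : R⟦X⟧ := expand k (NeZero.ne k) (pentagonalSeries R)

lemma euler_one : euler R 1 = pentagonalSeries R := by
  simp [euler]

lemma expand_euler (k l : ℕ) [NeZero k] [NeZero l] :
    expand k (NeZero.ne k) (euler R l) = euler R (k * l) := by
  simp only [euler]
  rw [expand_mul]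

variable {R} in
lemma continuous_of_continuous_coeff [TopologicalSpace R] {T : Type*} [TopologicalSpace T]
    {f : T → R⟦X⟧} (h : ∀ d, Continuous fun t => coeff d (f t)) : Continuous f :=
  continuous_iff_continuousAt.mpr fun _ =>
    (tendsto_iff_coeff_tendsto R _ _ _).mpr fun d => (h d).continuousAt

variable {R} in
lemma continuous_expand [TopologicalSpace R] (k : ℕ) (hk : k ≠ 0) :
    Continuous (expand k hk : R⟦X⟧ →ₐ[R] R⟦X⟧) := by
  refine continuous_of_continuous_coeff fun d => ?_
  by_cases h : k ∣ d
  · obtain ⟨m, hm⟩ := h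
    simp_rw [hm, coeff_expand_mul]
    exact continuous_coeff R m
  · simp_rw [coeff_expand_of_not_dvd _ _ _ h]
    exact continuous_const

lemma hasProd_euler [TopologicalSpace R] (k : ℕ) [NeZero k] :
    HasProd (fun n => (1 : R⟦X⟧) - X ^ (k * (n + 1))) (euler R k) := by
  have h := (hasProd_one_sub_X_pow R).map (expand k (NeZero.ne k) : R⟦X⟧ →ₐ[R] R⟦X⟧)
    (continuous_expand k _)
  convert! h using 2 with n
  simp [pow_mul]

lemma constantCoeff_euler (k : ℕ) [NeZero k] : constantCoeff (euler R k) = 1 := by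
  rw [euler, constantCoeff_expand, constantCoeff_pentagonalSeries]

lemma euler_ne_zero [Nontrivial R] (k : ℕ) [NeZero k] : euler R k ≠ 0 := fun h => by
  simpa [h] using constantCoeff_euler R k

/-- In characteristic `p`, `f_p = f_1 ^ p`. -/
lemma euler_prime_eq_pow (p : ℕ) [Fact p.Prime] [CharP R p] :
    haveI := NeZero.of_pos (Fact.out : p.Prime).pos
    euler R p = euler R 1 ^ p := by
  have := NeZero.of_pos (Fact.out : p.Prime).pos
  let : TopologicalSpace R := ⊥
  have : DiscreteTopology R := ⟨rfl⟩
  have : CharP R⟦X⟧ p := charP_of_injective_algebraMap (C_injective (R := R)) p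
  refine (hasProd_euler R p).unique ?_
  convert! (hasProd_euler R 1).map (powMonoidHom p : R⟦X⟧ →* R⟦X⟧) (continuous_pow p) using 2 with n
  simp only [Function.comp, powMonoidHom_apply]
  rw [sub_pow_char, one_pow, ← pow_mul, one_mul, mul_comm]

/-- The product over the indices divisible by `k` of a family indexed by the positive integers. -/
lemma hasProd_ite_dvd {M : Type*} [CommMonoid M] [TopologicalSpace M] (k : ℕ) [NeZero k]
    {h : ℕ → M} {a : M} (H : HasProd (fun n => h (k * (n + 1))) a) :
    HasProd (fun n => if k ∣ n + 1 then h (n + 1) else 1) a := by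
  have hk := Nat.pos_of_ne_zero (NeZero.ne k)
  have hpos (n : ℕ) : 0 < k * (n + 1) := by positivity
  have hi : Function.Injective fun n => k * (n + 1) - 1 := by
    intro a b hab
    have h1 := hpos a
    have h2 := hpos b
    simp only at hab
    have : k * (a + 1) = k * (b + 1) := by omega
    simpa using Nat.eq_of_mul_eq_mul_left hk this
  rw [← hi.hasProd_iff]
  · convert! H using 2 with n
    simp [Nat.sub_add_cancel (hpos n)]
  · intro n hn
    refine if_neg fun ⟨m, hm⟩ => hn ?_
    rcases m with _ | m
    · simp at hm
    · exact ⟨m, by simp only [← hm]; simp⟩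

/-- The generating function of the `m`-regular partitions is `f_m / f_1`. -/
lemma mk_card_restricted_mul_euler (m : ℕ) [NeZero m] :
    (PowerSeries.mk fun n => ((Nat.Partition.restricted n (¬ m ∣ ·)).card : R)) * euler R 1 =
      euler R m := by
  let : TopologicalSpace R := ⊥
  have : DiscreteTopology R := ⟨rfl⟩
  have hm := Nat.pos_of_ne_zero (NeZero.ne m)
  simp_rw [Nat.Partition.card_restricted_eq_card_countRestricted _ hm]
  refine ((Nat.Partition.hasProd_powerSeriesMk_card_countRestricted R hm).mul
    (hasProd_euler R 1)).unique ?_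
  convert! hasProd_euler R m using 2 with n
  simp_rw [one_mul, pow_mul]
  rw [geom_sum_mul_neg, ← pow_mul, ← pow_mul, mul_comm]

/-- The generating function of `(s, t)`-regular bipartitions is `f_s f_t / f_1 ^ 2`. -/
lemma mk_B_mul_euler_sq (s t : ℕ) [NeZero s] [NeZero t] :
    (PowerSeries.mk fun n => (B s t n : R)) * euler R 1 ^ 2 = euler R s * euler R t := by
  have h : (PowerSeries.mk fun n => (B s t n : R)) =
      (PowerSeries.mk fun n => ((Nat.Partition.restricted n (¬ s ∣ ·)).card : R)) *
        (PowerSeries.mk fun n => ((Nat.Partition.restricted n (¬ t ∣ ·)).card : R)) := by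
    ext n
    rw [coeff_mk, coeff_mul]
    simp [B, regularBipartitions, Finset.card_sigma, Finset.card_product]
  rw [h, ← mk_card_restricted_mul_euler R s, ← mk_card_restricted_mul_euler R t]
  ring

variable {R} in
lemma IsPrimitiveRoot.prod_one_sub_pow_mul [IsDomain R] {p : ℕ} (hp : 0 < p) {ζ : R}
    (hζ : IsPrimitiveRoot ζ p) (x : R) :
    ∏ i ∈ Finset.range p, (1 - ζ ^ i * x) = 1 - x ^ p := by
  classical
  rw [← one_pow (M := R) p, hζ.pow_sub_pow_eq_prod_sub_mul _ _ hp, one_pow,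
    Finset.prod_eq_multiset_prod, Finset.prod_eq_multiset_prod, Polynomial.nthRootsFinset_def,
    Multiset.toFinset_val, hζ.nthRoots_one_nodup.dedup, hζ.nthRoots_eq (one_pow p)]
  simp

/-- Euler's product over the conjugates `ζ ^ i X` of the variable, for a primitive root of unity
`ζ` of prime order `p`, equals `f_p ^ (p + 1) / f_(p ^ 2)`. -/
lemma prod_rescale_euler_mul [IsDomain R] {p : ℕ} (hp : p.Prime) [NeZero p] {ζ : R}
    (hζ : IsPrimitiveRoot ζ p) :
    (∏ i ∈ Finset.range p, rescale (ζ ^ i) (euler R 1)) * euler R (p * p) =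
      euler R p ^ (p + 1) := by
  let : TopologicalSpace R := ⊥
  have : DiscreteTopology R := ⟨rfl⟩
  have hcont (r : R) : Continuous (rescale r : R⟦X⟧ →+* R⟦X⟧) := by
    refine continuous_of_continuous_coeff fun d => ?_
    simp_rw [coeff_rescale]
    exact (continuous_coeff R d).const_mul _
  have h1 : HasProd (fun n => ∏ i ∈ Finset.range p,
      ((1 : R⟦X⟧) - C ((ζ ^ i) ^ (n + 1)) * X ^ (n + 1)))
      (∏ i ∈ Finset.range p, rescale (ζ ^ i) (euler R 1)) := by
    refine hasProd_prod fun i _ => ?_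
    convert! (hasProd_euler R 1).map (rescale (ζ ^ i)) (hcont _) using 2 with n
    simp [rescale_X, mul_pow]
  have h2 : HasProd (fun n => if p ∣ n + 1 then (1 : R⟦X⟧) - X ^ (p * (n + 1)) else 1)
      (euler R (p * p)) := by
    refine hasProd_ite_dvd p (h := fun n => (1 : R⟦X⟧) - X ^ (p * n)) ?_
    convert! hasProd_euler R (p * p) using 4
    ring
  have h3 : HasProd (fun n => if p ∣ n + 1 then ((1 : R⟦X⟧) - X ^ (n + 1)) ^ p else 1)
      (euler R p ^ p) :=
    hasProd_ite_dvd p (h := fun n => ((1 : R⟦X⟧) - X ^ n) ^ p)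
      ((hasProd_euler R p).map (powMonoidHom p : R⟦X⟧ →* R⟦X⟧) (continuous_pow p))
  -- The index `n` contributes `(1 - X ^ n) ^ p` to the product of conjugates if `p ∣ n`, and
  -- `1 - X ^ (p n)` otherwise; the factor `f_(p ^ 2)` supplies `1 - X ^ (p n)` where `p ∣ n`.
  refine (h1.mul h2).unique ?_
  rw [pow_succ]
  convert! h3.mul (hasProd_euler R p) using 2 with n
  split_ifs with h
  · obtain ⟨m, hm⟩ := h
    congr 1
    rw [hm, Finset.prod_congr rfl (g := fun _ => (1 : R⟦X⟧) - X ^ (p * m)), Finset.prod_const,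
      Finset.card_range]
    intro i _
    rw [← pow_mul, mul_left_comm, pow_mul, hζ.pow_eq_one]
    simp
  · rw [mul_one, one_mul]
    have hc : IsPrimitiveRoot (ζ ^ (n + 1)) p :=
      hζ.pow_of_coprime _ ((hp.coprime_iff_not_dvd).mpr h).symm
    have hc' : IsPrimitiveRoot (C (ζ ^ (n + 1)) : R⟦X⟧) p := hc.map_of_injective C_injective
    rw [mul_comm p, pow_mul, ← hc'.prod_one_sub_pow_mul hp.pos]
    refine Finset.prod_congr rfl fun i _ => ?_
    rw [← map_pow, ← pow_mul, ← pow_mul, mul_comm i]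

end EulerProduct

/-! ### Splitting a power series by exponents modulo 7 -/

section Residue

open PowerSeries

variable {R : Type*} [CommRing R]

/-- All exponents occurring in `f` are congruent to `r` modulo 7. -/
def HasResidue (r : ℕ) (f : R⟦X⟧) : Prop := ∀ n, n % 7 ≠ r % 7 → coeff n f = 0

namespace HasResidue

variable {r : ℕ} {f : R⟦X⟧}

lemma rescale_eq (hf : HasResidue r f) {ζ : R} (hζ : ζ ^ 7 = 1) :
    rescale ζ f = C (ζ ^ r) * f := by
  ext n
  rw [coeff_rescale, coeff_C_mul]
  by_cases h : n % 7 = r % 7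
  · rw [← Nat.div_add_mod n 7, ← Nat.div_add_mod r 7, h, pow_add, pow_add, pow_mul, pow_mul, hζ]
    simp
  · rw [hf n h, mul_zero, mul_zero]

end HasResidue

/-- The part of `f` with exponents congruent to `r` modulo 7. -/
noncomputable def residuePart (r : ℕ) (f : R⟦X⟧) : R⟦X⟧ :=
  PowerSeries.mk fun n => if n % 7 = r % 7 then coeff n f else 0

lemma coeff_residuePart (r n : ℕ) (f : R⟦X⟧) :
    coeff n (residuePart r f) = if n % 7 = r % 7 then coeff n f else 0 := coeff_mk _ _

lemma hasResidue_residuePart (r : ℕ) (f : R⟦X⟧) : HasResidue r (residuePart r f) := fun n hn => by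
  rw [coeff_residuePart, if_neg hn]

lemma residuePart_X_pow_mul (k r : ℕ) (f : R⟦X⟧) :
    residuePart (k + r) (X ^ k * f) = X ^ k * residuePart r f := by
  ext n
  simp only [coeff_residuePart, coeff_X_pow_mul']
  by_cases h : k ≤ n
  · simp only [h, if_true]
    congr 1
    rw [eq_iff_iff]
    omega
  · simp [h]

lemma eq_sum_residuePart (f : R⟦X⟧) : f = ∑ r ∈ Finset.range 7, residuePart r f := by
  ext n
  rw [map_sum, Finset.sum_eq_single_of_mem (n % 7) (Finset.mem_range.mpr (by omega))]
  · rw [coeff_residuePart, if_pos (by omega)]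
  · intro r hr hne
    rw [Finset.mem_range] at hr
    rw [coeff_residuePart, if_neg (by omega)]

/-- The components of a product are the convolution of the components of the factors; the index
`r + 6 i` stands for `r - i`. -/
lemma residuePart_mul (r : ℕ) (f g : R⟦X⟧) :
    residuePart r (f * g) =
      ∑ i ∈ Finset.range 7, residuePart i f * residuePart ((r + 6 * i) % 7) g := by
  ext n
  rw [coeff_residuePart, map_sum]
  simp only [coeff_mul]
  rw [Finset.sum_comm]
  split_ifs with h
  · refine Finset.sum_congr rfl fun p hp => ?_
    rw [Finset.HasAntidiagonal.mem_antidiagonal] at hp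
    rw [Finset.sum_eq_single_of_mem (p.1 % 7) (Finset.mem_range.mpr (by omega))]
    · rw [coeff_residuePart, coeff_residuePart, if_pos (by omega), if_pos (by omega)]
    · intro i hi hne
      rw [Finset.mem_range] at hi
      rw [coeff_residuePart, if_neg (by omega), zero_mul]
  · refine (Finset.sum_eq_zero fun p hp => Finset.sum_eq_zero fun i hi => ?_).symm
    rw [Finset.HasAntidiagonal.mem_antidiagonal] at hp
    rw [Finset.mem_range] at hi
    simp only [coeff_residuePart]
    split_ifs
    · omega
    · rw [mul_zero]
    · rw [zero_mul]
    · rw [zero_mul]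

lemma residuePart_mul_expand (r : ℕ) (f g : R⟦X⟧) :
    residuePart r (f * expand 7 (by norm_num) g) =
      residuePart r f * expand 7 (by norm_num) g := by
  ext n
  by_cases h : n % 7 = r % 7
  · rw [coeff_residuePart, if_pos h, coeff_mul, coeff_mul]
    refine Finset.sum_congr rfl fun p hp => ?_
    rw [Finset.HasAntidiagonal.mem_antidiagonal] at hp
    by_cases hd : 7 ∣ p.2
    · rw [coeff_residuePart, if_pos (by omega)]
    · rw [coeff_expand_of_not_dvd _ _ _ hd, mul_zero, mul_zero]
  · rw [coeff_residuePart, if_neg h, coeff_mul]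
    refine (Finset.sum_eq_zero fun p hp => ?_).symm
    rw [Finset.HasAntidiagonal.mem_antidiagonal] at hp
    by_cases hd : 7 ∣ p.2
    · rw [coeff_residuePart, if_neg (by omega), zero_mul]
    · rw [coeff_expand_of_not_dvd _ _ _ hd, mul_zero]

end Residue

/-! ### The 7-dissection of Euler's product -/

section Dissection

open PowerSeries

variable {R : Type*} [CommRing R]

lemma coeff_X_pow_mul_expand (r k m : ℕ) (hk : k ≠ 0) (f : R⟦X⟧) :
    coeff (k * m + r) (X ^ r * expand k hk f) = coeff m f := by
  rw [coeff_X_pow_mul, coeff_expand_mul]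

lemma coeff_X_pow_mul_expand_eq_zero (r k n : ℕ) (hk : k ≠ 0) (f : R⟦X⟧)
    (h : ∀ m, n = k * m + r → coeff m f = 0) : coeff n (X ^ r * expand k hk f) = 0 := by
  rw [coeff_X_pow_mul']
  split_ifs with h1
  · by_cases h2 : k ∣ n - r
    · obtain ⟨m, hm⟩ := h2
      rw [hm, coeff_expand_mul, h m (by omega)]
    · exact coeff_expand_of_not_dvd _ _ _ h2
  · rfl

lemma pentagonal_seven_mul_sub_one (i : ℤ) : pentagonal (7 * i - 1) = 49 * pentagonal i + 2 := by
  have h1 := two_mul_natCast_pentagonal (7 * i - 1)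
  have h2 := two_mul_natCast_pentagonal i
  zify
  linarith

lemma pentagonal_mod_seven (k : ℤ) :
    pentagonal k % 7 = 0 ∨ pentagonal k % 7 = 1 ∨ pentagonal k % 7 = 5 ∨
      pentagonal k % 7 = 2 ∧ ∃ i, k = 7 * i - 1 := by
  have h := two_mul_natCast_pentagonal k
  obtain ⟨i, hi⟩ : ∃ i, k = 7 * i + k % 7 := ⟨k / 7, by omega⟩
  have h2 : (2 * (pentagonal k : ℤ)) % 7 = ((k % 7) * (3 * (k % 7) - 1)) % 7 := by
    rw [h]
    exact Int.ModEq.mul (Int.mod_modEq k 7).symm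
      (Int.ModEq.sub (Int.ModEq.mul rfl (Int.mod_modEq k 7).symm) rfl)
  have h3 := Int.emod_nonneg k (show (7 : ℤ) ≠ 0 by norm_num)
  have h4 := Int.emod_lt_of_pos k (show (0 : ℤ) < 7 by norm_num)
  generalize k % 7 = j at *
  interval_cases j
  · omega
  · omega
  · omega
  · omega
  · omega
  · omega
  · exact Or.inr (Or.inr (Or.inr ⟨by omega, i + 1, by omega⟩))

/-- A generalized pentagonal number is congruent to 2 modulo 7 exactly when its index is
`7 i - 1`, and then it is `49` times the one of index `i`, plus 2. -/
lemma residuePart_two_euler :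
    residuePart 2 (euler R 1) = -(X ^ 2 * euler R 49) := by
  ext n
  rw [coeff_residuePart, euler_one, map_neg, euler]
  by_cases h : ∃ i, n = 49 * pentagonal i + 2
  · obtain ⟨i, rfl⟩ := h
    rw [coeff_X_pow_mul_expand, ← pentagonal_seven_mul_sub_one, coeff_pentagonalSeries_pentagonal,
      coeff_pentagonalSeries_pentagonal, pentagonal_seven_mul_sub_one, if_pos (by omega)]
    have h1 : (7 * i - 1).negOnePow = -i.negOnePow := by
      rw [← Int.negOnePow_succ, Int.negOnePow_eq_iff]
      exact ⟨3 * i - 1, by ring⟩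
    simp [h1]
  · rw [coeff_X_pow_mul_expand_eq_zero, neg_zero]
    · split_ifs with h1
      · refine coeff_pentagonalSeries_eq_zero R ?_
        rintro ⟨k, rfl⟩
        rcases pentagonal_mod_seven k with h2 | h2 | h2 | ⟨-, i, rfl⟩
        · omega
        · omega
        · omega
        · exact h ⟨i, pentagonal_seven_mul_sub_one i⟩
      · rfl
    · rintro m rfl
      refine coeff_pentagonalSeries_eq_zero R ?_
      rintro ⟨i, rfl⟩
      exact h ⟨i, rfl⟩

lemma residuePart_euler_eq_zero {r : ℕ} (hr : r % 7 = 3 ∨ r % 7 = 4 ∨ r % 7 = 6) :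
    residuePart r (euler R 1) = 0 := by
  ext n
  rw [coeff_residuePart, euler_one, map_zero]
  split_ifs with h
  · refine coeff_pentagonalSeries_eq_zero R ?_
    rintro ⟨k, rfl⟩
    have := pentagonal_mod_seven k
    omega
  · rfl

lemma euler_one_eq_sum_residuePart :
    euler R 1 = residuePart 0 (euler R 1) + residuePart 1 (euler R 1) +
      residuePart 2 (euler R 1) + residuePart 5 (euler R 1) := by
  conv_lhs => rw [eq_sum_residuePart (euler R 1)]
  simp only [Finset.sum_range_succ, Finset.sum_range_zero,
    residuePart_euler_eq_zero (R := R) (r := 3) (by simp),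
    residuePart_euler_eq_zero (R := R) (r := 4) (by simp),
    residuePart_euler_eq_zero (R := R) (r := 6) (by simp), add_zero, zero_add]

lemma choose_two_seven_mul_add_four (i : ℕ) :
    (7 * i + 3 + 1).choose 2 = 49 * (i + 1).choose 2 + 6 := by
  have h1 := two_mul_choose_two (7 * i + 3)
  have h2 := two_mul_choose_two i
  nlinarith

lemma choose_two_succ_mod_seven (j : ℕ) :
    (j + 1).choose 2 % 7 = 0 ∨ (j + 1).choose 2 % 7 = 1 ∨ (j + 1).choose 2 % 7 = 3 ∨
      (j + 1).choose 2 % 7 = 6 ∧ ∃ i, j = 7 * i + 3 := by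
  have h := two_mul_choose_two j
  obtain ⟨i, hi⟩ : ∃ i, j = 7 * i + j % 7 := ⟨j / 7, by omega⟩
  have h2 : (2 * (j + 1).choose 2) % 7 = ((j % 7) * (j % 7 + 1)) % 7 := by
    rw [h]
    exact Nat.ModEq.mul (Nat.mod_modEq j 7).symm (Nat.ModEq.add (Nat.mod_modEq j 7).symm rfl)
  have h4 := Nat.mod_lt j (show 0 < 7 by norm_num)
  generalize j % 7 = k at *
  interval_cases k
  · omega
  · omega
  · omega
  · exact Or.inr (Or.inr (Or.inr ⟨by omega, i, by omega⟩))
  · omega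
  · omega
  · omega

/-- A triangular number is congruent to 6 modulo 7 exactly when its index is `7 i + 3`, and then it
is `49` times the one of index `i`, plus 6; the coefficient `2 j + 1` becomes `7 (2 i + 1)`. -/
lemma residuePart_six_euler_cube [IsDomain R] :
    residuePart 6 (euler R 1 ^ 3) = -(7 * (X ^ 2 * euler R 49) ^ 3) := by
  have h3 : (7 * (X ^ 2 * euler R 49) ^ 3 : R⟦X⟧) =
      C 7 * (X ^ 6 * expand 49 (by norm_num) (pentagonalSeries R ^ 3)) := by
    rw [map_pow, map_ofNat, euler]
    ring
  ext n
  rw [coeff_residuePart, euler_one, h3, map_neg, coeff_C_mul]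
  by_cases h : ∃ i, n = 49 * (i + 1).choose 2 + 6
  · obtain ⟨i, rfl⟩ := h
    rw [coeff_X_pow_mul_expand, ← choose_two_seven_mul_add_four,
      coeff_pentagonalSeries_cube_triangular, coeff_pentagonalSeries_cube_triangular,
      choose_two_seven_mul_add_four, if_pos (by omega), pow_add, pow_mul]
    push_cast
    rw [show (-1 : R) ^ 7 = -1 by norm_num]
    ring
  · rw [coeff_X_pow_mul_expand_eq_zero, mul_zero, neg_zero]
    · split_ifs with h1
      · refine coeff_pentagonalSeries_cube_eq_zero ?_
        rintro j rfl
        rcases choose_two_succ_mod_seven j with h2 | h2 | h2 | ⟨-, i, rfl⟩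
        · omega
        · omega
        · omega
        · exact h ⟨i, choose_two_seven_mul_add_four i⟩
      · rfl
    · rintro m rfl
      refine coeff_pentagonalSeries_cube_eq_zero ?_
      rintro i rfl
      exact h ⟨i, rfl⟩

lemma residuePart_euler_cube_eq_zero [IsDomain R] {r : ℕ} (hr : r = 2 ∨ r = 4 ∨ r = 5) :
    residuePart r (euler R 1 ^ 3) = 0 := by
  ext n
  rw [coeff_residuePart, euler_one, map_zero]
  split_ifs with h
  · refine coeff_pentagonalSeries_cube_eq_zero ?_
    rintro j rfl
    have := choose_two_succ_mod_seven j
    omega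
  · rfl

end Dissection

/-! ### Polynomial identities satisfied by the components -/

section Algebra

variable {A : Type*} [CommRing A]

/-- The norm form of `a + ζ b + ζ ^ 2 c + ζ ^ 5 d` over the field generated by the seventh roots of
unity. Conjugate factors are paired first, which leaves a norm from the cubic subfield. -/
lemma prod_conjugates_eq {z a b c d : A} (hz : ∑ i ∈ Finset.range 7, z ^ i = 0) :
    ∏ i ∈ Finset.range 7, (a + z ^ i * b + z ^ (2 * i) * c + z ^ (5 * i) * d) =
      a ^ 7 + b ^ 7 + c ^ 7 + d ^ 7
        - 7 * (a ^ 5 * d * c + b ^ 5 * a * c + d ^ 5 * b * c)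
        + 14 * (a ^ 2 * b ^ 3 * c ^ 2 + b ^ 2 * d ^ 3 * c ^ 2 + d ^ 2 * a ^ 3 * c ^ 2)
        + 7 * (a ^ 4 * b ^ 2 * d + b ^ 4 * d ^ 2 * a + d ^ 4 * a ^ 2 * b)
        - 7 * (a ^ 3 * b * c ^ 3 + b ^ 3 * d * c ^ 3 + d ^ 3 * a * c ^ 3)
        + 14 * (a * b * d * c ^ 4) - 7 * ((a * b * d) ^ 2 * c) := by
  simp only [Finset.sum_range_succ, Finset.sum_range_zero, pow_zero, pow_one, zero_add] at hz
  have h7 : z ^ 7 = 1 := by linear_combination (z - 1) * hz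
  -- `s`, `t`, `u` generate the cubic subfield and are permuted cyclically.
  obtain ⟨s, hs⟩ : ∃ s, s = z + z ^ 6 := ⟨_, rfl⟩
  obtain ⟨t, ht⟩ : ∃ t, t = z ^ 2 + z ^ 5 := ⟨_, rfl⟩
  obtain ⟨u, hu⟩ : ∃ u, u = z ^ 3 + z ^ 4 := ⟨_, rfl⟩
  have hsum : s + t + u = -1 := by rw [hs, ht, hu]; linear_combination hz
  have hst : s * t = s + u := by rw [hs, ht, hu]; linear_combination (z + z ^ 4) * h7
  have htu : t * u = s + t := by rw [hs, ht, hu]; linear_combination (z + z ^ 2) * h7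
  have hsu : s * u = t + u := by rw [hs, ht, hu]; linear_combination (z ^ 2 + z ^ 3) * h7
  have hs2 : s ^ 2 = t + 2 := by rw [hs, ht]; linear_combination (z ^ 5 + 2) * h7
  have ht2 : t ^ 2 = u + 2 := by rw [ht, hu]; linear_combination (z ^ 3 + 2) * h7
  have hu2 : u ^ 2 = s + 2 := by rw [hu, hs]; linear_combination (z + 2) * h7
  have hstu : s * t * u = 1 := by linear_combination u * hst + hsu + hu2 + hsum
  have hp : t ^ 2 * u + s * u ^ 2 + s ^ 2 * t = 3 := by
    linear_combination u * ht2 + s * hu2 + t * hs2 + hs2 + ht2 + hu2 + 3 * hsum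
  have hr : t * u ^ 2 + s ^ 2 * u + s * t ^ 2 = -4 := by
    linear_combination t * hu2 + u * hs2 + s * ht2 + hst + htu + hsu + 4 * hsum
  have h3 : s ^ 3 + t ^ 3 + u ^ 3 = -4 := by
    linear_combination s * hs2 + t * ht2 + u * hu2 + hst + htu + hsu + 4 * hsum
  have e1 (i j k : ℕ) (h : i = 7 * j + k) : z ^ i = z ^ k := by
    rw [h, pow_add, pow_mul, h7, one_pow, one_mul]
  have p1 : (a + z * b + z ^ 2 * c + z ^ 5 * d) * (a + z ^ 6 * b + z ^ 5 * c + z ^ 2 * d) =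
      a ^ 2 + b ^ 2 + c ^ 2 + d ^ 2 + (a * b + b * c) * s + (a * c + a * d) * t +
        (b * d + c * d) * u := by
    rw [hs, ht, hu]
    linear_combination (b ^ 2 + c ^ 2 + d ^ 2 + z * b * c + z ^ 4 * b * d + z ^ 3 * c * d) * h7
  have p2 : (a + z ^ 2 * b + z ^ 4 * c + z ^ 3 * d) * (a + z ^ 5 * b + z ^ 3 * c + z ^ 4 * d) =
      a ^ 2 + b ^ 2 + c ^ 2 + d ^ 2 + (a * b + b * c) * t + (a * c + a * d) * u +
        (b * d + c * d) * s := by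
    rw [hs, ht, hu]
    linear_combination (b ^ 2 + c ^ 2 + d ^ 2 + z ^ 2 * b * c + z * b * d + z * c * d) * h7
  have p3 : (a + z ^ 3 * b + z ^ 6 * c + z * d) * (a + z ^ 4 * b + z * c + z ^ 6 * d) =
      a ^ 2 + b ^ 2 + c ^ 2 + d ^ 2 + (a * b + b * c) * u + (a * c + a * d) * s +
        (b * d + c * d) * t := by
    rw [hs, ht, hu]
    linear_combination (b ^ 2 + c ^ 2 + d ^ 2 + z ^ 3 * b * c + z ^ 2 * b * d + z ^ 5 * c * d) * h7
  have hcubic (k l m n : A) : (k + l * s + m * t + n * u) * (k + l * t + m * u + n * s) *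
      (k + l * u + m * s + n * t) =
      (l - k) ^ 3 + (m - k) ^ 3 + (n - k) ^ 3
        + 3 * ((l - k) ^ 2 * (m - k) + (m - k) ^ 2 * (n - k) + (n - k) ^ 2 * (l - k))
        - 4 * ((l - k) ^ 2 * (n - k) + (m - k) ^ 2 * (l - k) + (n - k) ^ 2 * (m - k))
        - (l - k) * (m - k) * (n - k) := by
    have q1 : k + l * s + m * t + n * u = (l - k) * s + (m - k) * t + (n - k) * u := by
      linear_combination k * hsum
    have q2 : k + l * t + m * u + n * s = (l - k) * t + (m - k) * u + (n - k) * s := by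
      linear_combination k * hsum
    have q3 : k + l * u + m * s + n * t = (l - k) * u + (m - k) * s + (n - k) * t := by
      linear_combination k * hsum
    rw [q1, q2, q3]
    generalize l - k = l, m - k = m, n - k = n
    linear_combination (l ^ 3 + m ^ 3 + n ^ 3) * hstu +
      (l ^ 2 * m + m ^ 2 * n + n ^ 2 * l) * hp + (l ^ 2 * n + m ^ 2 * l + n ^ 2 * m) * hr +
      l * m * n * (3 * hstu + h3)
  have key := hcubic (a ^ 2 + b ^ 2 + c ^ 2 + d ^ 2) (a * b + b * c) (a * c + a * d) (b * d + c * d)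
  rw [← p1, ← p2, ← p3] at key
  simp only [Finset.prod_range_succ, Finset.prod_range_zero, one_mul, mul_zero, pow_zero, pow_one,
    mul_one, Nat.reduceMul]
  rw [e1 8 1 1 rfl, e1 10 1 3 rfl, e1 12 1 5 rfl, e1 15 2 1 rfl, e1 20 2 6 rfl, e1 25 3 4 rfl,
    e1 30 4 2 rfl, pow_one]
  clear p1 p2 p3 hcubic
  generalize a + z * b + z ^ 2 * c + z ^ 5 * d = l1, a + z ^ 6 * b + z ^ 5 * c + z ^ 2 * d = l6,
    a + z ^ 2 * b + z ^ 4 * c + z ^ 3 * d = l2, a + z ^ 5 * b + z ^ 3 * c + z ^ 4 * d = l5,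
    a + z ^ 3 * b + z ^ 6 * c + z * d = l3, a + z ^ 4 * b + z * c + z ^ 6 * d = l4 at key ⊢
  have : (a + b + c + d) * l1 * l2 * l3 * l4 * l5 * l6 =
      (a + b + c + d) * (l1 * l6 * (l2 * l5) * (l3 * l4)) := by ring
  rw [this, key]
  ring

variable {a b c d : A}

/-- The variables `a, b, c, d` stand for the components of Euler's product with exponents congruent
to `0, 1, 2, 5` modulo 7, for which the four hypotheses hold. In terms of `x = a ^ 3 b`,
`y = b ^ 3 d`, `z = d ^ 3 a` and `w = c ^ 4` they become relations that parametrize a rational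
curve. -/
lemma quartic_relations (h1 : a ^ 2 * c + a * b ^ 2 + c ^ 2 * d = 0)
    (h2 : a * c ^ 2 + b ^ 2 * c + b * d ^ 2 = 0) (h3 : a ^ 2 * d + b * c ^ 2 + c * d ^ 2 = 0)
    (h4 : a * b * d = c ^ 3) :
    a ^ 3 * b * c ^ 4 + (a ^ 3 * b) * (b ^ 3 * d) + c ^ 8 = 0 ∧
    b ^ 3 * d * c ^ 4 + (b ^ 3 * d) * (d ^ 3 * a) + c ^ 8 = 0 ∧
    d ^ 3 * a * c ^ 4 + (d ^ 3 * a) * (a ^ 3 * b) + c ^ 8 = 0 := by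
  refine ⟨?_, ?_, ?_⟩
  · linear_combination a * b * c ^ 3 * h1 + (a ^ 2 * b ^ 3 - c ^ 5) * h4
  · linear_combination b * d * c ^ 3 * h2 + (b ^ 2 * d ^ 3 - c ^ 5) * h4
  · linear_combination d * a * c ^ 3 * h3 + (d ^ 2 * a ^ 3 - c ^ 5) * h4

variable [IsDomain A]

/-- Under the relations between the components, the norm form of `prod_conjugates_eq` is minus a
square divided by `c`. -/
lemma mul_normForm_eq_neg_sq (h1 : a ^ 2 * c + a * b ^ 2 + c ^ 2 * d = 0)
    (h2 : a * c ^ 2 + b ^ 2 * c + b * d ^ 2 = 0) (h3 : a ^ 2 * d + b * c ^ 2 + c * d ^ 2 = 0)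
    (h4 : a * b * d = c ^ 3) (hc : c ≠ 0) :
    c * (a ^ 7 + b ^ 7 + c ^ 7 + d ^ 7
        - 7 * (a ^ 5 * d * c + b ^ 5 * a * c + d ^ 5 * b * c)
        + 14 * (a ^ 2 * b ^ 3 * c ^ 2 + b ^ 2 * d ^ 3 * c ^ 2 + d ^ 2 * a ^ 3 * c ^ 2)
        + 7 * (a ^ 4 * b ^ 2 * d + b ^ 4 * d ^ 2 * a + d ^ 4 * a ^ 2 * b)
        - 7 * (a ^ 3 * b * c ^ 3 + b ^ 3 * d * c ^ 3 + d ^ 3 * a * c ^ 3)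
        + 14 * (a * b * d * c ^ 4) - 7 * ((a * b * d) ^ 2 * c)) =
      -(a ^ 3 * b + b ^ 3 * d + d ^ 3 * a + 8 * c ^ 4) ^ 2 := by
  obtain ⟨r1, r2, r3⟩ := quartic_relations h1 h2 h3 h4
  have h6 : c ^ 6 = (a * b * d) ^ 2 := by rw [h4]; ring
  have h9 : c ^ 9 = (a * b * d) ^ 3 := by rw [h4]; ring
  -- As `c ^ 9 = (a b d) ^ 3`, multiplication by `c ^ 9` turns the norm form into a polynomial in
  -- `x`, `y`, `z` and `w`.
  have hN : c ^ 9 * (a ^ 7 + b ^ 7 + c ^ 7 + d ^ 7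
        - 7 * (a ^ 5 * d * c + b ^ 5 * a * c + d ^ 5 * b * c)
        + 14 * (a ^ 2 * b ^ 3 * c ^ 2 + b ^ 2 * d ^ 3 * c ^ 2 + d ^ 2 * a ^ 3 * c ^ 2)
        + 7 * (a ^ 4 * b ^ 2 * d + b ^ 4 * d ^ 2 * a + d ^ 4 * a ^ 2 * b)
        - 7 * (a ^ 3 * b * c ^ 3 + b ^ 3 * d * c ^ 3 + d ^ 3 * a * c ^ 3)
        + 14 * (a * b * d * c ^ 4) - 7 * ((a * b * d) ^ 2 * c)) =
      (a ^ 3 * b) ^ 3 * (d ^ 3 * a) + (b ^ 3 * d) ^ 3 * (a ^ 3 * b) + (d ^ 3 * a) ^ 3 * (b ^ 3 * d)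
        - 7 * c ^ 4 * ((a ^ 3 * b) ^ 2 * (d ^ 3 * a) + (b ^ 3 * d) ^ 2 * (a ^ 3 * b) +
          (d ^ 3 * a) ^ 2 * (b ^ 3 * d))
        + 14 * c ^ 8 * ((a ^ 3 * b) * (b ^ 3 * d) + (b ^ 3 * d) * (d ^ 3 * a) +
          (d ^ 3 * a) * (a ^ 3 * b)) + 8 * c ^ 16 := by
    linear_combination (a ^ 7 + b ^ 7 + d ^ 7) * h9 -
      7 * (a ^ 5 * d * c ^ 4 + b ^ 5 * a * c ^ 4 + d ^ 5 * b * c ^ 4) * h6 -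
      14 * (a ^ 2 * b ^ 3 + b ^ 2 * d ^ 3 + d ^ 2 * a ^ 3) * c ^ 8 * h4 +
      7 * (a ^ 3 * b + b ^ 3 * d + d ^ 3 * a) * c ^ 9 * h4 + 14 * c ^ 13 * h4 + 7 * c ^ 10 * h6
  refine mul_left_cancel₀ (pow_ne_zero 8 hc) ?_
  generalize a ^ 3 * b = x, b ^ 3 * d = y, d ^ 3 * a = z at *
  linear_combination hN +
    ((x ^ 2 - c ^ 4 * x + c ^ 8) - 7 * c ^ 4 * (x - c ^ 4) + 16 * c ^ 8) * r3 +
    ((y ^ 2 - c ^ 4 * y + c ^ 8) - 7 * c ^ 4 * (y - c ^ 4) + 16 * c ^ 8) * r1 +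
    ((z ^ 2 - c ^ 4 * z + c ^ 8) - 7 * c ^ 4 * (z - c ^ 4) + 16 * c ^ 8) * r2

/-- The left-hand side is the component of `f_1 ^ 9 = (f_1 ^ 3) ^ 3` at the residue 4: its three
factors in parentheses are the components of `f_1 ^ 3` at the residues 0, 1, 3, and the one at 6 is
`7 c ^ 3`. The quartic `a ^ 3 b + b ^ 3 d + d ^ 3 a + 8 c ^ 4` is `-X f_7 ^ 4`, by
`euler_component_quartic`. -/
lemma residue_four_ninth_power (h1 : a ^ 2 * c + a * b ^ 2 + c ^ 2 * d = 0)
    (h2 : a * c ^ 2 + b ^ 2 * c + b * d ^ 2 = 0) (h3 : a ^ 2 * d + b * c ^ 2 + c * d ^ 2 = 0)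
    (h4 : a * b * d = c ^ 3) (hc : c ≠ 0) :
    343 * c ^ 9 + 6 * ((a ^ 3 + 6 * (a * c * d) + 3 * (b ^ 2 * d)) *
        (3 * (a ^ 2 * b) + 6 * (b * c * d) + d ^ 3) *
        (b ^ 3 + 6 * (a * b * c) + 3 * (a * d ^ 2))) =
      90 * (a ^ 3 * b + b ^ 3 * d + d ^ 3 * a + 8 * c ^ 4) ^ 2 * c
        - 882 * (a ^ 3 * b + b ^ 3 * d + d ^ 3 * a + 8 * c ^ 4) * c ^ 5 + 2401 * c ^ 9 := by
  obtain ⟨r1, r2, r3⟩ := quartic_relations h1 h2 h3 h4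
  have h12 : (a ^ 3 * b) * (b ^ 3 * d) * (d ^ 3 * a) = c ^ 12 := by
    linear_combination ((a * b * d) ^ 3 + (a * b * d) ^ 2 * c ^ 3 + (a * b * d) * c ^ 6 + c ^ 9) * h4
  have q0 : c ^ 3 * (a ^ 3 + 6 * (a * c * d) + 3 * (b ^ 2 * d)) =
      a * d * (a ^ 3 * b + 6 * c ^ 4 + 3 * (b ^ 3 * d)) := by
    linear_combination -(a ^ 3 + 3 * b ^ 2 * d) * h4
  have q1 : c ^ 3 * (3 * (a ^ 2 * b) + 6 * (b * c * d) + d ^ 3) =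
      b * d * (d ^ 3 * a + 6 * c ^ 4 + 3 * (a ^ 3 * b)) := by
    linear_combination -(d ^ 3 + 3 * a ^ 2 * b) * h4
  have q3 : c ^ 3 * (b ^ 3 + 6 * (a * b * c) + 3 * (a * d ^ 2)) =
      a * b * (b ^ 3 * d + 6 * c ^ 4 + 3 * (d ^ 3 * a)) := by
    linear_combination -(b ^ 3 + 3 * a * d ^ 2) * h4
  have hq : c ^ 3 * ((a ^ 3 + 6 * (a * c * d) + 3 * (b ^ 2 * d)) *
        (3 * (a ^ 2 * b) + 6 * (b * c * d) + d ^ 3) *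
        (b ^ 3 + 6 * (a * b * c) + 3 * (a * d ^ 2))) =
      (a ^ 3 * b + 6 * c ^ 4 + 3 * (b ^ 3 * d)) * (d ^ 3 * a + 6 * c ^ 4 + 3 * (a ^ 3 * b)) *
        (b ^ 3 * d + 6 * c ^ 4 + 3 * (d ^ 3 * a)) := by
    refine mul_left_cancel₀ (pow_ne_zero 6 hc) ?_
    generalize a ^ 3 * b + 6 * c ^ 4 + 3 * (b ^ 3 * d) = l,
      d ^ 3 * a + 6 * c ^ 4 + 3 * (a ^ 3 * b) = m,
      b ^ 3 * d + 6 * c ^ 4 + 3 * (d ^ 3 * a) = n,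
      a ^ 3 + 6 * (a * c * d) + 3 * (b ^ 2 * d) = l',
      3 * (a ^ 2 * b) + 6 * (b * c * d) + d ^ 3 = m',
      b ^ 3 + 6 * (a * b * c) + 3 * (a * d ^ 2) = n' at *
    calc c ^ 6 * (c ^ 3 * (l' * m' * n')) = (c ^ 3 * l') * (c ^ 3 * m') * (c ^ 3 * n') := by ring
      _ = (a * b * d) ^ 2 * (l * m * n) := by rw [q0, q1, q3]; ring
      _ = c ^ 6 * (l * m * n) := by rw [h4]; ring
  refine mul_left_cancel₀ (pow_ne_zero 3 hc) ?_
  clear q0 q1 q3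
  generalize a ^ 3 * b = x, b ^ 3 * d = y, d ^ 3 * a = z at *
  linear_combination 6 * hq + (18 * x + 54 * (y - c ^ 4) + 288 * c ^ 4) * r1 +
    (18 * y + 54 * (z - c ^ 4) + 288 * c ^ 4) * r2 +
    (18 * z + 54 * (x - c ^ 4) + 288 * c ^ 4) * r3 + 168 * h12

/-- The left-hand side is the component of `f_1 ^ 5 = f_1 ^ 3 f_1 ^ 2` at the residue 3. -/
lemma residue_three_fifth_power (h1 : a ^ 2 * c + a * b ^ 2 + c ^ 2 * d = 0)
    (h2 : a * c ^ 2 + b ^ 2 * c + b * d ^ 2 = 0) (h3 : a ^ 2 * d + b * c ^ 2 + c * d ^ 2 = 0)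
    (h4 : a * b * d = c ^ 3) (hc : c ≠ 0) :
    (a ^ 3 + 6 * (a * c * d) + 3 * (b ^ 2 * d)) * (2 * (b * c) + d ^ 2) +
        (3 * (a ^ 2 * b) + 6 * (b * c * d) + d ^ 3) * (b ^ 2 + 2 * (a * c)) +
        (b ^ 3 + 6 * (a * b * c) + 3 * (a * d ^ 2)) * (a ^ 2 + 2 * (c * d)) + 7 * c ^ 5 =
      10 * (a ^ 3 * b + b ^ 3 * d + d ^ 3 * a + 8 * c ^ 4) * c - 49 * c ^ 5 := by
  obtain ⟨r1, r2, r3⟩ := quartic_relations h1 h2 h3 h4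
  refine mul_left_cancel₀ (pow_ne_zero 3 hc) ?_
  have q0 : c ^ 3 * ((a ^ 3 + 6 * (a * c * d) + 3 * (b ^ 2 * d)) * (2 * (b * c) + d ^ 2)) =
      (a ^ 3 * b + 6 * c ^ 4 + 3 * (b ^ 3 * d)) * (2 * c ^ 4 + d ^ 3 * a) := by
    linear_combination (-(a ^ 3 + 3 * b ^ 2 * d) * (2 * (b * c) + d ^ 2) +
      2 * c * (a ^ 3 * b + 6 * c ^ 4 + 3 * (b ^ 3 * d))) * h4
  have q1 : c ^ 3 * ((3 * (a ^ 2 * b) + 6 * (b * c * d) + d ^ 3) * (b ^ 2 + 2 * (a * c))) =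
      (d ^ 3 * a + 6 * c ^ 4 + 3 * (a ^ 3 * b)) * (2 * c ^ 4 + b ^ 3 * d) := by
    linear_combination (-(d ^ 3 + 3 * a ^ 2 * b) * (b ^ 2 + 2 * (a * c)) +
      2 * c * (d ^ 3 * a + 6 * c ^ 4 + 3 * (a ^ 3 * b))) * h4
  have q3 : c ^ 3 * ((b ^ 3 + 6 * (a * b * c) + 3 * (a * d ^ 2)) * (a ^ 2 + 2 * (c * d))) =
      (b ^ 3 * d + 6 * c ^ 4 + 3 * (d ^ 3 * a)) * (2 * c ^ 4 + a ^ 3 * b) := by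
    linear_combination (-(b ^ 3 + 3 * a * d ^ 2) * (a ^ 2 + 2 * (c * d)) +
      2 * c * (b ^ 3 * d + 6 * c ^ 4 + 3 * (d ^ 3 * a))) * h4
  generalize a ^ 3 * b = x, b ^ 3 * d = y, d ^ 3 * a = z at *
  linear_combination q0 + q1 + q3 + 4 * (r1 + r2 + r3)

end Algebra

/-! ### The components of powers of Euler's product -/

section Components

open PowerSeries

variable {R : Type*} [CommRing R]

variable {f a b c d : R⟦X⟧}

/-- The components of `f` are `a, b, c, d` at the residues `0, 1, 2, 5` modulo 7, and zero at the
other residues, as is the case for Euler's product. -/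
structure IsDissection (f a b c d : R⟦X⟧) : Prop where
  zero : residuePart 0 f = a
  one : residuePart 1 f = b
  two : residuePart 2 f = c
  three : residuePart 3 f = 0
  four : residuePart 4 f = 0
  five : residuePart 5 f = d
  six : residuePart 6 f = 0

lemma IsDissection.residuePart_sq (h : IsDissection f a b c d) :
    residuePart 0 (f ^ 2) = a ^ 2 + 2 * (c * d) ∧ residuePart 1 (f ^ 2) = 2 * (a * b) ∧
    residuePart 2 (f ^ 2) = b ^ 2 + 2 * (a * c) ∧ residuePart 3 (f ^ 2) = 2 * (b * c) + d ^ 2 ∧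
    residuePart 4 (f ^ 2) = c ^ 2 ∧ residuePart 5 (f ^ 2) = 2 * (a * d) ∧
    residuePart 6 (f ^ 2) = 2 * (b * d) := by
  obtain ⟨h0, h1, h2, h3, h4, h5, h6⟩ := h
  rw [pow_two f]
  simp only [residuePart_mul, Finset.sum_range_succ, Finset.sum_range_zero, Nat.reduceMul,
    Nat.reduceAdd, Nat.reduceMod, h0, h1, h2, h3, h4, h5, h6, mul_zero, zero_mul, add_zero, zero_add]
  refine ⟨?_, ?_, ?_, ?_, ?_, ?_, ?_⟩ <;> ring

lemma IsDissection.residuePart_cube (h : IsDissection f a b c d) :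
    residuePart 0 (f ^ 3) = a ^ 3 + 6 * (a * c * d) + 3 * (b ^ 2 * d) ∧
    residuePart 1 (f ^ 3) = 3 * (a ^ 2 * b) + 6 * (b * c * d) + d ^ 3 ∧
    residuePart 2 (f ^ 3) = 3 * (a ^ 2 * c + a * b ^ 2 + c ^ 2 * d) ∧
    residuePart 3 (f ^ 3) = b ^ 3 + 6 * (a * b * c) + 3 * (a * d ^ 2) ∧
    residuePart 4 (f ^ 3) = 3 * (a * c ^ 2 + b ^ 2 * c + b * d ^ 2) ∧
    residuePart 5 (f ^ 3) = 3 * (a ^ 2 * d + b * c ^ 2 + c * d ^ 2) ∧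
    residuePart 6 (f ^ 3) = c ^ 3 + 6 * (a * b * d) := by
  obtain ⟨s0, s1, s2, s3, s4, s5, s6⟩ := h.residuePart_sq
  obtain ⟨h0, h1, h2, h3, h4, h5, h6⟩ := h
  rw [pow_succ' f 2]
  simp only [residuePart_mul _ f (f ^ 2), Finset.sum_range_succ, Finset.sum_range_zero,
    Nat.reduceMul, Nat.reduceAdd, Nat.reduceMod, h0, h1, h2, h3, h4, h5, h6, s0, s1, s2, s3, s4, s5,
    s6, mul_zero, zero_mul, add_zero, zero_add]
  refine ⟨?_, ?_, ?_, ?_, ?_, ?_, ?_⟩ <;> ring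

lemma isDissection_euler : IsDissection (euler R 1) (residuePart 0 (euler R 1))
    (residuePart 1 (euler R 1)) (residuePart 2 (euler R 1)) (residuePart 5 (euler R 1)) :=
  ⟨rfl, rfl, rfl, residuePart_euler_eq_zero (by simp), residuePart_euler_eq_zero (by simp), rfl,
    residuePart_euler_eq_zero (by simp)⟩

lemma residuePart_two_euler_ne_zero [IsDomain R] : residuePart 2 (euler R 1) ≠ 0 := by
  rw [residuePart_two_euler]
  exact neg_ne_zero.mpr (mul_ne_zero (pow_ne_zero 2 X_ne_zero) (euler_ne_zero R 49))

/-- The relations between the components of Euler's product, read off from the components of its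
cube, which Jacobi's identity provides. -/
lemma euler_component_relations [IsDomain R] (h2 : (2 : R) ≠ 0) (h3 : (3 : R) ≠ 0)
    {a b c d : R⟦X⟧} (h : IsDissection (euler R 1) a b c d) :
    a ^ 2 * c + a * b ^ 2 + c ^ 2 * d = 0 ∧ a * c ^ 2 + b ^ 2 * c + b * d ^ 2 = 0 ∧
      a ^ 2 * d + b * c ^ 2 + c * d ^ 2 = 0 ∧ a * b * d = c ^ 3 := by
  have h2' : (2 : R⟦X⟧) ≠ 0 := by
    rw [← map_ofNat (C : R →+* R⟦X⟧)]
    exact (map_ne_zero_iff _ C_injective).mpr h2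
  have h3' : (3 : R⟦X⟧) ≠ 0 := by
    rw [← map_ofNat (C : R →+* R⟦X⟧)]
    exact (map_ne_zero_iff _ C_injective).mpr h3
  obtain ⟨-, -, c2, -, c4, c5, c6⟩ := h.residuePart_cube
  rw [residuePart_euler_cube_eq_zero (by simp)] at c2 c4 c5
  have hc : c = -(X ^ 2 * euler R 49) := by rw [← h.two, residuePart_two_euler]
  rw [residuePart_six_euler_cube] at c6
  refine ⟨?_, ?_, ?_, ?_⟩
  · exact (mul_eq_zero.mp c2.symm).resolve_left h3'
  · exact (mul_eq_zero.mp c4.symm).resolve_left h3'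
  · exact (mul_eq_zero.mp c5.symm).resolve_left h3'
  · refine mul_left_cancel₀ (mul_ne_zero h2' h3') ?_
    have hc3 : (X ^ 2 * euler R 49) ^ 3 = -c ^ 3 := by rw [hc]; ring
    rw [hc3] at c6
    linear_combination -c6

/-- The function `f_7 ^ 4` in terms of the components of Euler's product. Its square is computed
from the product of Euler's product over all `ζ ^ i X`, and the sign from the lowest
coefficient. -/
lemma euler_component_quartic [IsDomain R] (h2 : (2 : R) ≠ 0) (h3 : (3 : R) ≠ 0) {ζ : R}
    (hζ : IsPrimitiveRoot ζ 7) {a b c d : R⟦X⟧} (h : IsDissection (euler R 1) a b c d) :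
    a ^ 3 * b + b ^ 3 * d + d ^ 3 * a + 8 * c ^ 4 = -(X * euler R 7 ^ 4) := by
  obtain ⟨r1, r2, r3, r4⟩ := euler_component_relations h2 h3 h
  have hc : c = -(X ^ 2 * euler R 49) := by rw [← h.two, residuePart_two_euler]
  have hc0 : c ≠ 0 := by rw [← h.two]; exact residuePart_two_euler_ne_zero
  have hN := mul_normForm_eq_neg_sq r1 r2 r3 r4 hc0
  have hz : ∑ i ∈ Finset.range 7, (C ζ : R⟦X⟧) ^ i = 0 :=
    (hζ.map_of_injective C_injective).geom_sum_eq_zero (by norm_num)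
  rw [← prod_conjugates_eq hz] at hN
  have hprod := prod_rescale_euler_mul R (show Nat.Prime 7 by norm_num) hζ
  have hfac (i : ℕ) : rescale (ζ ^ i) (euler R 1) =
      a + C ζ ^ i * b + C ζ ^ (2 * i) * c + C ζ ^ (5 * i) * d := by
    have h7 : (ζ ^ i) ^ 7 = 1 := by rw [← pow_mul, mul_comm, pow_mul, hζ.pow_eq_one, one_pow]
    conv_lhs => rw [euler_one_eq_sum_residuePart]
    rw [map_add, map_add, map_add, (hasResidue_residuePart 0 _).rescale_eq h7,
      (hasResidue_residuePart 1 _).rescale_eq h7, (hasResidue_residuePart 2 _).rescale_eq h7,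
      (hasResidue_residuePart 5 _).rescale_eq h7, h.zero, h.one, h.two, h.five]
    simp only [map_pow, map_one, ← pow_mul, pow_zero, one_mul, pow_one, mul_comm i]
  simp only [hfac] at hprod
  have hsq : (a ^ 3 * b + b ^ 3 * d + d ^ 3 * a + 8 * c ^ 4) ^ 2 = (X * euler R 7 ^ 4) ^ 2 := by
    have h49 : euler R (7 * 7) = euler R 49 := rfl
    rw [h49] at hprod
    generalize ∏ i ∈ Finset.range 7, (a + C ζ ^ i * b + C ζ ^ (2 * i) * c + C ζ ^ (5 * i) * d) = P
      at hN hprod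
    rw [hc] at hN
    rw [hc]
    linear_combination X ^ 2 * hprod + hN
  refine (sq_eq_sq_iff_eq_or_eq_neg.mp hsq).resolve_left fun hpos => ?_
  -- The other sign is excluded by the coefficients of `X`, which are `-1` and `1`.
  have hX {r : ℕ} (hr : r % 7 ≠ 0) : X ∣ residuePart r (euler R 1) := by
    rw [X_dvd_iff, ← coeff_zero_eq_constantCoeff_apply, coeff_residuePart, if_neg (by omega)]
  obtain ⟨b', hb⟩ := hX (r := 1) (by norm_num)
  obtain ⟨c', hc'⟩ := hX (r := 2) (by norm_num)
  obtain ⟨d', hd⟩ := hX (r := 5) (by norm_num)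
  rw [h.one] at hb
  rw [h.two] at hc'
  rw [h.five] at hd
  have ha : constantCoeff a = 1 := by
    rw [← h.zero, ← coeff_zero_eq_constantCoeff_apply, coeff_residuePart, if_pos rfl,
      coeff_zero_eq_constantCoeff_apply, constantCoeff_euler]
  have hb' : constantCoeff b' = -1 := by
    have h1 : coeff 1 b = constantCoeff b' := by
      rw [hb, ← coeff_zero_eq_constantCoeff_apply]
      exact coeff_succ_X_mul 0 b'
    rw [← h1, ← h.one, coeff_residuePart, if_pos rfl, euler_one]
    have := coeff_pentagonalSeries_pentagonal R 1
    simpa [pentagonal_def] using this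
  have hcancel : a ^ 3 * b' + X * (b ^ 2 * b' * d' + d * d' ^ 2 * a + 8 * c ^ 2 * c' ^ 2) =
      euler R 7 ^ 4 := by
    refine mul_left_cancel₀ (X_ne_zero : (X : R⟦X⟧) ≠ 0) ?_
    rw [← hpos]
    linear_combination (-a ^ 3 - b ^ 2 * d) * hb - b ^ 2 * X * b' * hd -
      (d ^ 2 * a + d * X * d' * a) * hd - 8 * c ^ 2 * (c + X * c') * hc'
  have h1 := congrArg constantCoeff hcancel
  simp only [map_add, map_mul, map_pow, constantCoeff_X, zero_mul, add_zero, ha, hb',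
    constantCoeff_euler, one_pow, one_mul] at h1
  exact h2 (by linear_combination -h1)

lemma residuePart_four_euler_pow_nine [IsDomain R] (h2 : (2 : R) ≠ 0) (h3 : (3 : R) ≠ 0) {ζ : R}
    (hζ : IsPrimitiveRoot ζ 7) :
    residuePart 4 (euler R 1 ^ 9) = -(X ^ 4 * (90 * (euler R 7 ^ 8 * euler R 49) +
      882 * (X ^ 7 * (euler R 7 ^ 4 * euler R 49 ^ 5)) + 2401 * (X ^ 14 * euler R 49 ^ 9))) := by
  have h := isDissection_euler (R := R)
  have hc0 := residuePart_two_euler_ne_zero (R := R)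
  have hc := residuePart_two_euler (R := R)
  obtain ⟨r1, r2, r3, r4⟩ := euler_component_relations h2 h3 h
  have hS := euler_component_quartic h2 h3 hζ h
  have h9 := residue_four_ninth_power r1 r2 r3 r4 hc0
  obtain ⟨e0, e1, e2, e3, e4, e5, e6⟩ := h.residuePart_cube
  generalize residuePart 0 (euler R 1) = a, residuePart 1 (euler R 1) = b,
    residuePart 2 (euler R 1) = c, residuePart 5 (euler R 1) = d at *
  rw [r1, mul_zero] at e2
  rw [r2, mul_zero] at e4
  rw [r3, mul_zero] at e5
  rw [hS, ← e0, ← e1, ← e3] at h9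
  have e6' : residuePart 6 (euler R 1 ^ 3) = 7 * c ^ 3 := by rw [e6, r4]; ring
  have hpow : euler R 1 ^ 9 = euler R 1 ^ 3 * (euler R 1 ^ 3 * euler R 1 ^ 3) := by ring
  rw [hpow]
  simp only [residuePart_mul, Finset.sum_range_succ, Finset.sum_range_zero, Nat.reduceMul,
    Nat.reduceAdd, Nat.reduceMod, e2, e4, e5, e6', mul_zero, zero_mul, add_zero, zero_add]
  rw [hc] at h9 ⊢
  linear_combination h9

lemma residuePart_three_euler_pow_five [IsDomain R] (h2 : (2 : R) ≠ 0) (h3 : (3 : R) ≠ 0) {ζ : R}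
    (hζ : IsPrimitiveRoot ζ 7) :
    residuePart 3 (euler R 1 ^ 5) = X ^ 3 * (10 * (euler R 7 ^ 4 * euler R 49) +
      49 * (X ^ 7 * euler R 49 ^ 5)) := by
  have h := isDissection_euler (R := R)
  have hc0 := residuePart_two_euler_ne_zero (R := R)
  have hc := residuePart_two_euler (R := R)
  obtain ⟨r1, r2, r3, r4⟩ := euler_component_relations h2 h3 h
  have hS := euler_component_quartic h2 h3 hζ h
  have h5 := residue_three_fifth_power r1 r2 r3 r4 hc0
  obtain ⟨e0, e1, e2, e3, e4, e5, e6⟩ := h.residuePart_cube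
  obtain ⟨s0, s1, s2, s3, s4, s5, s6⟩ := h.residuePart_sq
  generalize residuePart 0 (euler R 1) = a, residuePart 1 (euler R 1) = b,
    residuePart 2 (euler R 1) = c, residuePart 5 (euler R 1) = d at *
  rw [r1, mul_zero] at e2
  rw [r2, mul_zero] at e4
  rw [r3, mul_zero] at e5
  rw [hS, ← e0, ← e1, ← e3, ← s0, ← s2, ← s3] at h5
  have e6' : residuePart 6 (euler R 1 ^ 3) = 7 * c ^ 3 := by rw [e6, r4]; ring
  have hpow : euler R 1 ^ 5 = euler R 1 ^ 3 * euler R 1 ^ 2 := by ring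
  rw [hpow]
  simp only [residuePart_mul, Finset.sum_range_succ, Finset.sum_range_zero, Nat.reduceMul,
    Nat.reduceAdd, Nat.reduceMod, e2, e4, e5, e6', s4, mul_zero, zero_mul, add_zero, zero_add]
  rw [hc] at h5 ⊢
  linear_combination h5

end Components

/-! ### The operator `U` on the space spanned by three eta products -/

section UOperator

open PowerSeries

/-- The operator extracting the coefficients of index `7 n + 4`. In terms of the exponents `3 n + 2`
of the associated eta products, it is the operator `U_7`. -/
noncomputable def extract {R : Type*} [CommRing R] (f : R⟦X⟧) : R⟦X⟧ :=
  PowerSeries.mk fun n => coeff (7 * n + 4) f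

variable {R : Type*} [CommRing R]

lemma coeff_extract (f : R⟦X⟧) (n : ℕ) : coeff n (extract f) = coeff (7 * n + 4) f := coeff_mk _ _

lemma extract_add (f g : R⟦X⟧) : extract (f + g) = extract f + extract g := by
  ext n
  simp only [coeff_extract, map_add]

lemma extract_C_mul (r : R) (f : R⟦X⟧) : extract (C r * f) = C r * extract f := by
  ext n
  simp only [coeff_extract, coeff_C_mul]

lemma extract_eq_of_residuePart {f g : R⟦X⟧}
    (h : residuePart 4 f = X ^ 4 * expand 7 (by norm_num) g) : extract f = g := by
  ext n
  rw [coeff_extract, ← coeff_X_pow_mul_expand 4 7 n (by norm_num) g, ← h, coeff_residuePart,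
    if_pos (by omega)]

lemma two_mul_pow_sub_two (k : ℕ) : 3 * ((2 * 7 ^ k - 2) / 3) + 2 = 2 * 7 ^ k := by
  have h : 7 ^ k % 3 = 1 := by simp [Nat.pow_mod]
  omega

/-- The index map `n ↦ 7 n + 4` is `N ↦ 7 N` in terms of `N = 3 n + 2`, which gives its iterates. -/
lemma coeff_iterate_extract (f : R⟦X⟧) (k n : ℕ) :
    coeff n (extract^[k] f) = coeff (7 ^ k * n + (2 * 7 ^ k - 2) / 3) f := by
  induction k generalizing n with
  | zero => simp
  | succ k ih =>
    rw [Function.iterate_succ_apply', coeff_extract, ih]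
    have h1 := two_mul_pow_sub_two k
    have h2 := two_mul_pow_sub_two (k + 1)
    have h3 : 4 * 7 ^ k + (2 * 7 ^ k - 2) / 3 = (2 * 7 ^ (k + 1) - 2) / 3 := by omega
    rw [← h3, show 7 ^ k * (7 * n + 4) + (2 * 7 ^ k - 2) / 3 =
      7 ^ (k + 1) * n + (4 * 7 ^ k + (2 * 7 ^ k - 2) / 3) by ring]

lemma iterate_extract_C_mul (r : R) (f : R⟦X⟧) (k : ℕ) :
    extract^[k] (C r * f) = C r * extract^[k] f := by
  induction k with
  | zero => rfl
  | succ k ih => rw [Function.iterate_succ_apply', Function.iterate_succ_apply', ih, extract_C_mul]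

variable (R) in
/-- The eta products `η(z) ^ (9 - 4 i) η(7 z) ^ (1 + 4 i)` for `i = 0, 1, 2`, divided by
`q ^ (2 / 3)`. -/
noncomputable def etaProduct (i : ℕ) : R⟦X⟧ :=
  X ^ i * (euler R 1 ^ (9 - 4 * i) * euler R 7 ^ (1 + 4 * i))

lemma expand_etaProduct (i : ℕ) : expand 7 (by norm_num) (etaProduct R i) =
    X ^ (7 * i) * (euler R 7 ^ (9 - 4 * i) * euler R 49 ^ (1 + 4 * i)) := by
  have h1 : expand 7 (by norm_num) (euler R 1) = euler R 7 := expand_euler R 7 1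
  have h2 : expand 7 (by norm_num) (euler R 7) = euler R 49 := expand_euler R 7 7
  simp only [etaProduct, map_mul, map_pow, expand_X, h1, h2, pow_mul]

lemma residuePart_etaProduct (i r : ℕ) : residuePart (i + r) (etaProduct R i) =
    X ^ i * (residuePart r (euler R 1 ^ (9 - 4 * i)) * euler R 7 ^ (1 + 4 * i)) := by
  have h1 : euler R 7 ^ (1 + 4 * i) = expand 7 (by norm_num) (euler R 1 ^ (1 + 4 * i)) := by
    rw [map_pow]
    exact congrArg (· ^ (1 + 4 * i)) (expand_euler R 7 1).symm
  rw [etaProduct, residuePart_X_pow_mul, h1, residuePart_mul_expand]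

lemma extract_etaProduct_two : extract (etaProduct R 2) = -etaProduct R 0 := by
  refine extract_eq_of_residuePart ?_
  rw [map_neg, expand_etaProduct, residuePart_etaProduct 2 2]
  norm_num [residuePart_two_euler]
  ring

lemma extract_etaProduct_zero [IsDomain R] (h2 : (2 : R) ≠ 0) (h3 : (3 : R) ≠ 0) {ζ : R}
    (hζ : IsPrimitiveRoot ζ 7) : extract (etaProduct R 0) =
      C (-90) * etaProduct R 0 + C (-882) * etaProduct R 1 + C (-2401) * etaProduct R 2 := by
  refine extract_eq_of_residuePart ?_
  have h := residuePart_etaProduct (R := R) 0 4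
  simp only [zero_add, mul_zero, Nat.sub_zero, residuePart_four_euler_pow_nine h2 h3 hζ] at h
  rw [h]
  simp only [map_add, map_mul, expand_etaProduct, map_neg, map_ofNat]
  ring

lemma extract_etaProduct_one [IsDomain R] (h2 : (2 : R) ≠ 0) (h3 : (3 : R) ≠ 0) {ζ : R}
    (hζ : IsPrimitiveRoot ζ 7) : extract (etaProduct R 1) =
      C 10 * etaProduct R 0 + C 49 * etaProduct R 1 := by
  refine extract_eq_of_residuePart ?_
  have h := residuePart_etaProduct (R := R) 1 3
  simp only [Nat.reduceAdd, Nat.reduceMul, Nat.reduceSub,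
    residuePart_three_euler_pow_five h2 h3 hζ] at h
  rw [h]
  simp only [map_add, map_mul, expand_etaProduct, map_ofNat]
  ring

/-- The factor `f_7 ^ 9` does not affect residues modulo 7, so the third eta product inherits the
gaps between the exponents of Euler's product. -/
lemma coeff_etaProduct_two_eq_zero {n : ℕ} (h : n % 7 = 1 ∨ n % 7 = 5 ∨ n % 7 = 6) :
    coeff n (etaProduct R 2) = 0 := by
  have h1 : coeff n (residuePart (2 + (n + 5)) (etaProduct R 2)) = 0 := by
    rw [residuePart_etaProduct, pow_one, residuePart_euler_eq_zero (by omega), zero_mul, mul_zero,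
      map_zero]
  rwa [coeff_residuePart, if_pos (by omega)] at h1

section Char11

instance fact_prime_eleven : Fact (Nat.Prime 11) := ⟨by norm_num⟩

variable {K : Type*} [Field K] [Algebra (ZMod 11) K]

variable (K) in
/-- The combination of the three eta products with coefficients in the prime field. -/
noncomputable def etaCombination (v : ZMod 11 × ZMod 11 × ZMod 11) : K⟦X⟧ :=
  C (algebraMap (ZMod 11) K v.1) * etaProduct K 0 +
    C (algebraMap (ZMod 11) K v.2.1) * etaProduct K 1 +
    C (algebraMap (ZMod 11) K v.2.2) * etaProduct K 2

/-- The action of `extract` on coordinates, the entries being `-90, -882, -2401, 10, 49, -1`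
modulo 11. -/
def extractCoords (v : ZMod 11 × ZMod 11 × ZMod 11) : ZMod 11 × ZMod 11 × ZMod 11 :=
  (9 * v.1 + 10 * v.2.1 + 10 * v.2.2, 9 * v.1 + 5 * v.2.1, 8 * v.1)

lemma extract_etaCombination {ζ : K} (hζ : IsPrimitiveRoot ζ 7) (v : ZMod 11 × ZMod 11 × ZMod 11) :
    extract (etaCombination K v) = etaCombination K (extractCoords v) := by
  have h2 : (2 : K) ≠ 0 := by
    rw [← map_ofNat (algebraMap (ZMod 11) K)]
    exact (map_ne_zero _).mpr (by decide)
  have h3 : (3 : K) ≠ 0 := by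
    rw [← map_ofNat (algebraMap (ZMod 11) K)]
    exact (map_ne_zero _).mpr (by decide)
  have h11 : (11 : K⟦X⟧) = 0 := by
    rw [← map_ofNat (C : K →+* K⟦X⟧), ← map_ofNat (algebraMap (ZMod 11) K),
      show (OfNat.ofNat 11 : ZMod 11) = 0 from by decide, map_zero, map_zero]
  simp only [etaCombination, extractCoords, extract_add, extract_C_mul,
    extract_etaProduct_zero h2 h3 hζ, extract_etaProduct_one h2 h3 hζ, extract_etaProduct_two,
    map_add, map_mul, map_neg, map_ofNat]
  generalize C (algebraMap (ZMod 11) K v.1) = x, C (algebraMap (ZMod 11) K v.2.1) = y,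
    C (algebraMap (ZMod 11) K v.2.2) = z
  linear_combination (-9 * x * etaProduct K 0 - 81 * x * etaProduct K 1 - 219 * x * etaProduct K 2 +
    4 * y * etaProduct K 1 - z * etaProduct K 0) * h11

lemma iterate_extract_etaCombination {ζ : K} (hζ : IsPrimitiveRoot ζ 7)
    (v : ZMod 11 × ZMod 11 × ZMod 11) (k : ℕ) :
    extract^[k] (etaCombination K v) = etaCombination K (extractCoords^[k] v) :=
  ((show Function.Semiconj (etaCombination K) extractCoords extract from
    fun v => (extract_etaCombination hζ v).symm).iterate_right k v).symm

lemma iterate_eleven_extract_etaProduct_zero {ζ : K} (hζ : IsPrimitiveRoot ζ 7) :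
    extract^[11] (etaProduct K 0) = C (algebraMap (ZMod 11) K 8) * etaProduct K 2 := by
  have h := iterate_extract_etaCombination hζ (1, 0, 0) 11
  rw [show extractCoords^[11] (1, 0, 0) = (0, 0, 8) from by decide] at h
  simpa only [etaCombination, map_one, map_zero, one_mul, zero_mul, add_zero, zero_add] using h

lemma iterate_twelve_extract_etaProduct_zero {ζ : K} (hζ : IsPrimitiveRoot ζ 7) :
    extract^[12] (etaProduct K 0) = C (algebraMap (ZMod 11) K 3) * etaProduct K 0 := by
  have h := iterate_extract_etaCombination hζ (1, 0, 0) 12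
  rw [show extractCoords^[12] (1, 0, 0) = (3, 0, 0) from by decide] at h
  simpa only [etaCombination, map_one, map_zero, one_mul, zero_mul, add_zero, zero_add] using h

lemma iterate_twelve_mul_extract_etaProduct_zero {ζ : K} (hζ : IsPrimitiveRoot ζ 7) (m : ℕ) :
    extract^[12 * m] (etaProduct K 0) = C (algebraMap (ZMod 11) K (3 ^ m)) * etaProduct K 0 := by
  induction m with
  | zero => simp
  | succ m ih =>
    rw [Nat.mul_succ, Nat.add_comm, Function.iterate_add_apply, ih, iterate_extract_C_mul,
      iterate_twelve_extract_etaProduct_zero hζ, ← mul_assoc, ← map_mul, ← map_mul, pow_succ]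

/-- Modulo 11, the generating function `f_7 f_11 / f_1 ^ 2` becomes `f_1 ^ 9 f_7`. -/
lemma coeff_etaProduct_zero (n : ℕ) : coeff n (etaProduct K 0) = (B 7 11 n : K) := by
  have : CharP K 11 := charP_of_injective_algebraMap (algebraMap (ZMod 11) K).injective 11
  have h1 := mk_B_mul_euler_sq K 7 11
  have h2 : euler K 11 = euler K 1 ^ 11 := euler_prime_eq_pow K 11
  have h3 : etaProduct K 0 = PowerSeries.mk fun n => (B 7 11 n : K) := by
    refine mul_right_cancel₀ (pow_ne_zero 2 (euler_ne_zero K 1)) ?_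
    rw [h1, h2, etaProduct]
    ring
  rw [h3, coeff_mk]

end Char11

end UOperator

theorem theorem2 (n m : ℕ) :
    B 7 11 (7 ^ (12 * m) * n + (2 * 7 ^ (12 * m) - 2) / 3) ≡ 3 ^ m * B 7 11 n [MOD 11] ∧
    ∀ k : ℕ, k = 1 ∨ k = 5 ∨ k = 6 →
      B 7 11 (7 ^ (12 * m + 11) * (7 * n + k) + (2 * 7 ^ (12 * m + 11) - 2) / 3) ≡ 0 [MOD 11] := by
  -- The field of coefficients needs a primitive seventh root of unity, which `ZMod 11` lacks.
  let K := AlgebraicClosure (ZMod 11)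
  have : CharP K 11 := charP_of_injective_algebraMap (algebraMap (ZMod 11) K).injective 11
  have : NeZero ((7 : ℕ) : K) := ⟨fun h => by
    rw [CharP.cast_eq_zero_iff K 11] at h
    omega⟩
  obtain ⟨ζ, hζ⟩ := HasEnoughRootsOfUnity.exists_primitiveRoot K 7
  constructor
  · rw [← CharP.natCast_eq_natCast K 11, ← coeff_etaProduct_zero, ← coeff_iterate_extract,
      iterate_twelve_mul_extract_etaProduct_zero hζ, PowerSeries.coeff_C_mul, coeff_etaProduct_zero,
      map_pow, map_ofNat, Nat.cast_mul, Nat.cast_pow, Nat.cast_ofNat]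
  · intro k hk
    rw [← CharP.natCast_eq_natCast K 11, ← coeff_etaProduct_zero, ← coeff_iterate_extract,
      Nat.add_comm (12 * m), Function.iterate_add_apply,
      iterate_twelve_mul_extract_etaProduct_zero hζ, iterate_extract_C_mul,
      iterate_eleven_extract_etaProduct_zero hζ, PowerSeries.coeff_C_mul, PowerSeries.coeff_C_mul,
      coeff_etaProduct_two_eq_zero (by omega), mul_zero, mul_zero, Nat.cast_zero]
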